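/- Let $m\ge 2$ be an integer. Let $\mathbb H_2$ be the Siegel upper half space of symmetric complex matrices $\tau=\begin{pmatrix}\tau_{11}&\tau_{12}\\ \tau_{12}&\tau_{22}\end{pmatrix}$ with positive definite imaginary part, and write $\mathbf e(x)=e^{2\pi i x}$. For $\tau\in\mathbb H_2$ let $\Lambda_\tau=\mathbb Z^2+\tau\mathbb Z^2$ and $A_\tau=\mathbb C^2/\Lambda_\tau$, with the principal polarization given by the Hermitian form $H(z,z')=z^{t}(\operatorname{Im}\tau)^{-1}\overline{z'}$. The exponent of an abelian subvariety $Z\subseteq A_\tau$ is the exponent of the finite group that is the kernel of the polarization induced on $Z$. Let $\mathcal S$ be the complex manifold obtained as the quotient of $\mathbb H_2\times(\mathbb C^\times)^2$ by the free and properly discontinuous action of $\mathrm{Sym}(2,\mathbb Z)\times\mathbb Z^2$ in which $S\in \mathrm{Sym}(2,\mathbb Z)$ acts by $(\tau,w)\mapsto(\tau+S,w)$ and $(n_1,n_2)\in\mathbb Z^2$ acts by $$(\tau,(w_1,w_2))\mapsto\bigl(\tau,(\mathbf e(n_1\tau_{11}+n_2\tau_{12})w_1,\ \mathbf e(n_1\tau_{12}+n_2\tau_{22})w_2)\bigr).$$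 Let $\Psi:\mathbb H_2\to\mathbb C^3$ be the map $$\Psi(\tau)=(t_1t_2,\ t_2t_3,\ t_2^{-1}),\qquad t_1=\mathbf e(\tau_{11}),\ t_2=\mathbf e(\tau_{12}),\ t_3=\mathbf e(\tau_{22}),$$ which identifies $\mathrm{Sym}(2,\mathbb Z)\backslash\mathbb H_2$ with its image. It induces a holomorphic map $\mathcal S\to\mathbb C^3$, $[\tau,w]\mapsto\Psi(\tau)$, with image $\Psi(\mathbb H_2)$, whose fibre over $\Psi(\tau)$ is identified with $A_\tau$ by $(z_1,z_2)\mapsto[\tau,(\mathbf e(z_1),\mathbf e(z_2))]$. Let $i$ be either a pair $(c,e)\in\mathbb N^2$ (with $0\in\mathbb N$) such that $\gcd(m,c,e)=1$, or the symbol $\infty$. Put $$O_{(c,e)}=\Psi\left(\left\{\begin{pmatrix}\mu&-\frac{c\tau+e}{m}\\-\frac{c\tau+e}{m}&\tau\end{pmatrix}\in\mathbb H_2\right\}\right),\qquad O_\infty=\Psi\left(\left\{\begin{pmatrix}\tau&z\\z&\frac{1}{m-1}(\tau-(m-2)z)\end{pmatrix}\in\mathbb H_2\right\}\right),$$ let $\mathcal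 S_i\to O_i$ be the restriction of $\mathcal S$ to $O_i$, and put $W_{(c,e)}=\langle(1,0)\rangle_{\mathbb C}$ and $W_\infty=\langle(-1,1)\rangle_{\mathbb C}$ in $\mathbb C^2$. Then there exist a (Hausdorff, second countable) complex manifold $\mathcal K_i$ of dimension $3$, a holomorphic map $\mathcal K_i\to\mathbb C^3$ with values in $O_i$, and a holomorphic map $\mathcal K_i\to\mathcal S$ with values in $\mathcal S_i$ which is compatible with the projections to $O_i$, such that for every $T\in O_i$: 1. the fibre $(\mathcal K_i)_T$ (as a complex analytic space) is an elliptic curve; 2. the induced map $(\mathcal K_i)_T\to(\mathcal S_i)_T$ is injective, and $\mathcal K_i\to\mathcal S$ is an immersion at each point of $(\mathcal K_i)_T$; moreover, for every $\tau\in\mathbb H_2$ with $\Psi(\tau)=T$, under the identification $(\mathcal S_i)_T\cong A_\tau$ the image of $(\mathcal K_i)_T$ is the image of $W_i$ in $A_\tau$, and this is an abelian subvariety of $A_\tau$ of exponent $m$. -/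

import Mathlib

open scoped Manifold ContDiff Matrix

namespace SplitSurfaces

/-! ### Quotients of complex manifolds by free properly discontinuous holomorphic actions -/

/-- The quotient of a complex manifold by a free, properly discontinuous, holomorphic action is a
complex manifold, for the charted space structure that makes the quotient map a local
biholomorphism. -/
theorem isManifold_quotient {E : Type*} [NormedAddCommGroup E] [NormedSpace ℂ E]
    {M : Type*} [TopologicalSpace M] [ChartedSpace E M] [IsManifold 𝓘(ℂ, E) ω M]
    {G : Type*} [AddGroup G] [AddAction G M]
    [ProperlyDiscontinuousVAdd G M] [ContinuousConstVAdd G M] [IsCancelVAdd G M]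
    [T2Space M] [LocallyCompactSpace M]
    (hG : ∀ g : G, ContMDiff 𝓘(ℂ, E) 𝓘(ℂ, E) ω (fun x : M => g +ᵥ x)) :
    IsManifold 𝓘(ℂ, E) ω (AddAction.orbitRel.Quotient G M) := by
  have hloc : IsLocalHomeomorph (Quotient.mk (AddAction.orbitRel G M)) :=
    (isAddQuotientCoveringMap_quotientMk_of_properlyDiscontinuousVAdd
      (G := G) (E := M)).isCoveringMap.isLocalHomeomorph
  have key : ∀ a a' : M, ContDiffOn ℂ ω
      (((hloc.localInverseAt a).trans (chartAt E a)).symm ≫ₕ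
        ((hloc.localInverseAt a').trans (chartAt E a')))
      (((hloc.localInverseAt a).trans (chartAt E a)).symm ≫ₕ
        ((hloc.localInverseAt a').trans (chartAt E a'))).source := by
    intro a a' u hu
    simp only [OpenPartialHomeomorph.trans_source, OpenPartialHomeomorph.symm_source,
      OpenPartialHomeomorph.trans_target, OpenPartialHomeomorph.coe_trans_symm, Set.mem_inter_iff,
      Set.mem_preimage, Function.comp_apply, IsLocalHomeomorph.localInverseAt_symm] at hu
    obtain ⟨⟨hu1, -⟩, hu3, hu4⟩ := hu
    set y := (chartAt E a).symm u with hy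
    set z := hloc.localInverseAt a' (Quotient.mk _ y) with hz
    have hmk : Quotient.mk (AddAction.orbitRel G M) z = Quotient.mk _ y :=
      hloc.apply_localInverseAt_of_mem hu3
    obtain ⟨g, hg⟩ : ∃ g : G, g +ᵥ y = z := Quotient.exact hmk
    have hzt : z ∈ (hloc.localInverseAt a').target :=
      (hloc.localInverseAt a').map_source hu3
    have hc : ContMDiffAt 𝓘(ℂ, E) 𝓘(ℂ, E) ω (chartAt E a).symm u :=
      (contMDiffOn_chart_symm (x := a)).contMDiffAt ((chartAt E a).open_target.mem_nhds hu1)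
    have hgc : ContMDiffAt 𝓘(ℂ, E) 𝓘(ℂ, E) ω (fun v => g +ᵥ (chartAt E a).symm v) u :=
      (hG g).contMDiffAt.comp u hc
    have hc2 : ContMDiffAt 𝓘(ℂ, E) 𝓘(ℂ, E) ω (chartAt E a') z :=
      (contMDiffOn_chart (x := a')).contMDiffAt ((chartAt E a').open_source.mem_nhds hu4)
    have hF : ContMDiffAt 𝓘(ℂ, E) 𝓘(ℂ, E) ω
        (fun v => chartAt E a' (g +ᵥ (chartAt E a).symm v)) u :=
      ContMDiffAt.comp u (by rw [← hy, hg]; exact hc2) hgc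
    have hev : (((hloc.localInverseAt a).trans (chartAt E a)).symm ≫ₕ
        ((hloc.localInverseAt a').trans (chartAt E a')) : E → E) =ᶠ[nhds u]
        (fun v => chartAt E a' (g +ᵥ (chartAt E a).symm v)) := by
      have hmem : ∀ᶠ v in nhds u, g +ᵥ (chartAt E a).symm v ∈ (hloc.localInverseAt a').target :=
        hgc.continuousAt.eventually_mem ((hloc.localInverseAt a').open_target.mem_nhds
          (by simpa only [← hy, hg] using hzt))
      filter_upwards [hmem] with v hv
      have h1 : Quotient.mk (AddAction.orbitRel G M) ((chartAt E a).symm v)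
          = (hloc.localInverseAt a').symm (g +ᵥ (chartAt E a).symm v) := by
        rw [hloc.localInverseAt_symm]
        exact (Quotient.sound ⟨g, rfl⟩ : Quotient.mk (AddAction.orbitRel G M) _ = _).symm
      simp only [OpenPartialHomeomorph.coe_trans, OpenPartialHomeomorph.coe_trans_symm,
        Function.comp_apply, IsLocalHomeomorph.localInverseAt_symm]
      rw [h1, (hloc.localInverseAt a').right_inv hv]
    exact ((contMDiffAt_iff_contDiffAt.mp hF).congr_of_eventuallyEq hev).contDiffWithinAt
  apply isManifold_of_contDiffOn
  rintro e e' ⟨q, rfl⟩ ⟨q', rfl⟩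
  simpa only [modelWithCornersSelf_coe, Function.id_comp, modelWithCornersSelf_coe_symm,
    Function.comp_id, Set.preimage_id, Set.range_id, Set.inter_univ] using key _ _

/-! ### The Siegel upper half space and the family of principally polarized abelian surfaces -/

/-- The symmetric matrix with entries `τ₁₁ = t 0`, `τ₁₂ = τ₂₁ = t 1`, `τ₂₂ = t 2`. -/
def symMat (t : Fin 3 → ℂ) : Matrix (Fin 2) (Fin 2) ℂ := !![t 0, t 1; t 1, t 2]

/-- The imaginary part of the period matrix. -/
def imMat (t : Fin 3 → ℂ) : Matrix (Fin 2) (Fin 2) ℝ := (symMat t).map Complex.im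

/-- The Siegel upper half space of degree two, in the coordinates `(τ₁₁, τ₁₂, τ₂₂)`. -/
def siegel : Set (Fin 3 → ℂ) := {t | (imMat t).PosDef}

theorem mem_siegel_iff (t : Fin 3 → ℂ) :
    t ∈ siegel ↔ 0 < (t 0).im ∧ 0 < (t 0).im * (t 2).im - (t 1).im ^ 2 := by
  have hq : ∀ x : Fin 2 → ℝ, star x ⬝ᵥ (imMat t *ᵥ x) =
      (t 0).im * x 0 ^ 2 + 2 * (t 1).im * (x 0 * x 1) + (t 2).im * x 1 ^ 2 := by
    intro x
    simp [imMat, symMat, dotProduct, Matrix.mulVec, Fin.sum_univ_two]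
    ring
  rw [siegel, Set.mem_ofPred_eq, Matrix.posDef_iff_dotProduct_mulVec]
  constructor
  · rintro ⟨-, h⟩
    have h0 : 0 < (t 0).im := by
      have := h (x := ![1, 0]) (by intro h; simpa using congrFun h 0)
      rw [hq] at this
      simpa using this
    refine ⟨h0, ?_⟩
    have := h (x := ![-(t 1).im, (t 0).im]) (by
      intro h
      exact h0.ne' (by simpa using congrFun h 1))
    rw [hq] at this
    simp only [Matrix.cons_val_zero, Matrix.cons_val_one] at this
    have h2 : 0 < (t 0).im * ((t 0).im * (t 2).im - (t 1).im ^ 2) := by nlinarith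
    exact pos_of_mul_pos_right h2 h0.le
  · rintro ⟨h0, hD⟩
    refine ⟨?_, ?_⟩
    · ext i j
      fin_cases i <;> fin_cases j <;> simp [imMat, symMat]
    · intro x hx
      rw [hq]
      have key : (t 0).im * ((t 0).im * x 0 ^ 2 + 2 * (t 1).im * (x 0 * x 1) + (t 2).im * x 1 ^ 2)
          = ((t 0).im * x 0 + (t 1).im * x 1) ^ 2
            + ((t 0).im * (t 2).im - (t 1).im ^ 2) * x 1 ^ 2 := by ring
      have hpos : 0 < ((t 0).im * x 0 + (t 1).im * x 1) ^ 2
            + ((t 0).im * (t 2).im - (t 1).im ^ 2) * x 1 ^ 2 := by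
        by_cases h1 : x 1 = 0
        · have hx0 : x 0 ≠ 0 := by
            intro hx0
            apply hx
            ext i
            fin_cases i <;> simp [hx0, h1]
          rw [h1]
          have : 0 < ((t 0).im * x 0) ^ 2 := by positivity
          simpa using this
        · have : 0 < x 1 ^ 2 := by positivity
          have := mul_pos hD this
          positivity
      rw [← key] at hpos
      exact pos_of_mul_pos_right hpos h0.le

/-- `e(x) = exp (2πix)`. -/
noncomputable def expTwoPiI (x : ℂ) : ℂ := Complex.exp (2 * Real.pi * Complex.I * x)

theorem expTwoPiI_add (x y : ℂ) : expTwoPiI (x + y) = expTwoPiI x * expTwoPiI y := by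
  rw [expTwoPiI, mul_add, Complex.exp_add, expTwoPiI, expTwoPiI]

theorem expTwoPiI_intCast (n : ℤ) : expTwoPiI (n : ℂ) = 1 := by
  rw [expTwoPiI, mul_comm]
  exact Complex.exp_int_mul_two_pi_mul_I n

theorem expTwoPiI_ne_zero (x : ℂ) : expTwoPiI x ≠ 0 := Complex.exp_ne_zero _

theorem log_norm_expTwoPiI (x : ℂ) : Real.log ‖expTwoPiI x‖ = -(2 * Real.pi * x.im) := by
  rw [expTwoPiI, Complex.norm_exp, Real.log_exp]
  simp

theorem contDiff_expTwoPiI : ContDiff ℂ ω expTwoPiI := by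
  unfold expTwoPiI
  fun_prop

/-- `ℍ₂ × (ℂˣ)²`, as an open subset of `ℂ³ × ℂ²`. -/
def totalSpace : TopologicalSpace.Opens ((Fin 3 → ℂ) × (Fin 2 → ℂ)) where
  carrier := {p | p.1 ∈ siegel ∧ ∀ i, p.2 i ≠ 0}
  is_open' := by
    simp only [mem_siegel_iff, Fin.forall_fin_two]
    refine IsOpen.inter (IsOpen.inter ?_ ?_) (IsOpen.inter ?_ ?_)
    · exact isOpen_lt (g := fun p : (Fin 3 → ℂ) × (Fin 2 → ℂ) => (p.1 0).im) continuous_const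
        (by fun_prop)
    · exact isOpen_lt (g := fun p : (Fin 3 → ℂ) × (Fin 2 → ℂ) =>
        (p.1 0).im * (p.1 2).im - (p.1 1).im ^ 2) continuous_const (by fun_prop)
    · exact isOpen_ne_fun (f := fun p : (Fin 3 → ℂ) × (Fin 2 → ℂ) => p.2 0) (by fun_prop)
        continuous_const
    · exact isOpen_ne_fun (f := fun p : (Fin 3 → ℂ) × (Fin 2 → ℂ) => p.2 1) (by fun_prop)
        continuous_const

/-- The group `Sym(2, ℤ) × ℤ²`: the translations `τ ↦ τ + S` by integral symmetric matrices (in the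
coordinates `(S₁₁, S₁₂, S₂₂)`), and the group `ℤ²` that acts on the fibres `(ℂˣ)²`. -/
abbrev PeriodGroup : Type := (Fin 3 → ℤ) × (Fin 2 → ℤ)

theorem add_int_mem_siegel {t : Fin 3 → ℂ} (ht : t ∈ siegel) (s : Fin 3 → ℤ) :
    (fun i => (s i : ℂ) + t i) ∈ siegel := by
  rw [mem_siegel_iff] at ht ⊢
  simpa using ht

/-- The element `(S, n)` sends `(τ, w)` to `(τ + S, (e(n₁τ₁₁ + n₂τ₁₂) w₁, e(n₁τ₁₂ + n₂τ₂₂) w₂))`. -/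
noncomputable instance : VAdd PeriodGroup totalSpace where
  vadd g p := ⟨(fun i => (g.1 i : ℂ) + p.1.1 i,
    fun i => expTwoPiI ((symMat p.1.1 *ᵥ (fun j => (g.2 j : ℂ))) i) * p.1.2 i),
    add_int_mem_siegel p.2.1 g.1, fun i => mul_ne_zero (expTwoPiI_ne_zero _) (p.2.2 i)⟩

theorem vadd_fst (g : PeriodGroup) (p : totalSpace) :
    (g +ᵥ p).1.1 = fun i => (g.1 i : ℂ) + p.1.1 i := rfl

theorem vadd_snd (g : PeriodGroup) (p : totalSpace) :
    (g +ᵥ p).1.2 = fun i => expTwoPiI ((symMat p.1.1 *ᵥ (fun j => (g.2 j : ℂ))) i) * p.1.2 i := rfl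

noncomputable instance : AddAction PeriodGroup totalSpace where
  zero_vadd p := by
    apply Subtype.ext
    refine Prod.ext ?_ ?_
    · rw [vadd_fst]
      simp
    · rw [vadd_snd]
      ext i
      have := expTwoPiI_intCast 0
      fin_cases i <;> simp_all [symMat, Matrix.mulVec, dotProduct]
  add_vadd g h p := by
    apply Subtype.ext
    refine Prod.ext ?_ ?_
    · simp only [vadd_fst]
      ext i
      simp [add_assoc]
    · simp only [vadd_snd, vadd_fst]
      ext i
      rw [← mul_assoc, ← expTwoPiI_add]
      congr 1
      have hS : ∀ n : ℤ, ∀ x y : ℂ, x = y + n → expTwoPiI y = expTwoPiI x := by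
        intro n x y hxy
        rw [hxy, expTwoPiI_add, expTwoPiI_intCast, mul_one]
      fin_cases i
      · apply hS (h.1 0 * g.2 0 + h.1 1 * g.2 1)
        simp [symMat, Matrix.mulVec, dotProduct, Fin.sum_univ_two]
        ring
      · apply hS (h.1 1 * g.2 0 + h.1 2 * g.2 1)
        simp [symMat, Matrix.mulVec, dotProduct, Fin.sum_univ_two]
        ring

/-- Real coordinates on `ℍ₂ × (ℂˣ)²` on which the group acts by integral translations: the real part
of `τ`, and `(Im τ)⁻¹` applied to `-(log ‖w‖) / 2π`. -/
noncomputable def realCoord (p : totalSpace) : (Fin 3 → ℝ) × (Fin 2 → ℝ) :=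
  (fun i => (p.1.1 i).re,
    ![((p.1.1 2).im * -(Real.log ‖p.1.2 0‖) - (p.1.1 1).im * -(Real.log ‖p.1.2 1‖)) /
        (2 * Real.pi * ((p.1.1 0).im * (p.1.1 2).im - (p.1.1 1).im ^ 2)),
      ((p.1.1 0).im * -(Real.log ‖p.1.2 1‖) - (p.1.1 1).im * -(Real.log ‖p.1.2 0‖)) /
        (2 * Real.pi * ((p.1.1 0).im * (p.1.1 2).im - (p.1.1 1).im ^ 2))])

theorem denom_ne_zero (p : totalSpace) :
    2 * Real.pi * ((p.1.1 0).im * (p.1.1 2).im - (p.1.1 1).im ^ 2) ≠ 0 := by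
  have := ((mem_siegel_iff _).1 p.2.1).2
  have := Real.pi_pos
  positivity

theorem continuous_realCoord : Continuous realCoord := by
  unfold realCoord
  refine Continuous.prodMk (by fun_prop) ?_
  refine continuous_pi fun i => ?_
  have h0 : Continuous fun p : totalSpace => Real.log ‖p.1.2 0‖ :=
    Continuous.log (by fun_prop) fun p => norm_ne_zero_iff.2 (p.2.2 0)
  have h1 : Continuous fun p : totalSpace => Real.log ‖p.1.2 1‖ :=
    Continuous.log (by fun_prop) fun p => norm_ne_zero_iff.2 (p.2.2 1)
  fin_cases i
  · exact Continuous.div (by fun_prop) (by fun_prop) denom_ne_zero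
  · exact Continuous.div (by fun_prop) (by fun_prop) denom_ne_zero

theorem realCoord_vadd (g : PeriodGroup) (p : totalSpace) :
    realCoord (g +ᵥ p) =
      (fun i => (g.1 i : ℝ), fun i => (g.2 i : ℝ)) + realCoord p := by
  have hD := denom_ne_zero p
  have hlog : ∀ i, Real.log ‖(g +ᵥ p).1.2 i‖ =
      -(2 * Real.pi * ((symMat p.1.1 *ᵥ (fun j => (g.2 j : ℂ))) i).im) +
        Real.log ‖p.1.2 i‖ := by
    intro i
    rw [vadd_snd, norm_mul, Real.log_mul (norm_ne_zero_iff.2 (expTwoPiI_ne_zero _))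
      (norm_ne_zero_iff.2 (p.2.2 i)), log_norm_expTwoPiI]
  refine Prod.ext ?_ ?_
  · ext i
    simp [realCoord, vadd_fst]
  · have him : ∀ i, ((g +ᵥ p).1.1 i).im = (p.1.1 i).im := by
      intro i
      simp [vadd_fst]
    ext i
    fin_cases i
    · simp only [realCoord, hlog, him, Prod.snd_add, Pi.add_apply]
      simp [symMat, Matrix.mulVec, dotProduct, Fin.sum_univ_two]
      rw [div_eq_iff hD, add_mul, div_mul_cancel₀ _ hD]
      ring
    · simp only [realCoord, hlog, him, Prod.snd_add, Pi.add_apply]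
      simp [symMat, Matrix.mulVec, dotProduct, Fin.sum_univ_two]
      rw [div_eq_iff hD, add_mul, div_mul_cancel₀ _ hD]
      ring

theorem contMDiff_vadd (g : PeriodGroup) :
    ContMDiff 𝓘(ℂ, (Fin 3 → ℂ) × (Fin 2 → ℂ)) 𝓘(ℂ, (Fin 3 → ℂ) × (Fin 2 → ℂ)) ω
      (fun p : totalSpace => g +ᵥ p) := by
  intro p
  refine (ChartedSpace.liftPropWithinAt_subtypeVal_comp_iff ..).1 ?_
  have hF : ContDiff ℂ ω (fun p : (Fin 3 → ℂ) × (Fin 2 → ℂ) =>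
      ((fun i => (g.1 i : ℂ) + p.1 i,
        fun i => expTwoPiI ((symMat p.1 *ᵥ (fun j => (g.2 j : ℂ))) i) * p.2 i) :
        (Fin 3 → ℂ) × (Fin 2 → ℂ))) := by
    refine ContDiff.prodMk (by fun_prop) ?_
    refine contDiff_pi.2 fun i => ?_
    refine ContDiff.mul (contDiff_expTwoPiI.comp ?_) (by fun_prop)
    fin_cases i
    · simp only [symMat, Matrix.mulVec, dotProduct, Fin.sum_univ_two, Fin.zero_eta, Matrix.of_apply,
        Matrix.cons_val_zero, Matrix.cons_val_one]
      fun_prop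
    · simp only [symMat, Matrix.mulVec, dotProduct, Fin.sum_univ_two, Fin.mk_one, Matrix.of_apply,
        Matrix.cons_val_zero, Matrix.cons_val_one]
      fun_prop
  exact (hF.contMDiff.comp contMDiff_subtype_val) p

instance : ContinuousConstVAdd PeriodGroup totalSpace where
  continuous_const_vadd g := (contMDiff_vadd g).continuous

instance : IsCancelVAdd PeriodGroup totalSpace where
  left_cancel' g p q h := by
    have := congrArg (fun x => -g +ᵥ x) h
    simpa using this
  right_cancel' g h p hgh := by
    have := congrArg realCoord hgh
    rw [realCoord_vadd, realCoord_vadd, add_left_inj] at this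
    refine Prod.ext ?_ ?_
    · ext i
      simpa using congrFun (congrArg Prod.fst this) i
    · ext i
      simpa using congrFun (congrArg Prod.snd this) i

instance : ProperlyDiscontinuousVAdd PeriodGroup totalSpace where
  finite_disjoint_inter_image := by
    intro K L hK hL
    have hC : IsCompact ((fun x : ((Fin 3 → ℝ) × (Fin 2 → ℝ)) × ((Fin 3 → ℝ) × (Fin 2 → ℝ)) =>
        x.1 - x.2) '' ((realCoord '' L) ×ˢ (realCoord '' K))) :=
      ((hL.image continuous_realCoord).prod (hK.image continuous_realCoord)).image (by fun_prop)
    obtain ⟨R, hR⟩ := hC.isBounded.exists_norm_le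
    have hfin : (Set.Icc (-⌈R⌉) ⌈R⌉).Finite := Set.finite_Icc _ _
    refine Set.Finite.subset ((Set.Finite.pi' (fun _ : Fin 3 => hfin)).prod
      (Set.Finite.pi' (fun _ : Fin 2 => hfin))) ?_
    rintro g ⟨_, ⟨p, hp, rfl⟩, hq⟩
    have hmem := hR _ ⟨(realCoord (g +ᵥ p), realCoord p), ⟨⟨_, hq, rfl⟩, ⟨_, hp, rfl⟩⟩, rfl⟩
    simp only [realCoord_vadd, add_sub_cancel_right] at hmem
    have hb : ∀ n : ℤ, |(n : ℝ)| ≤ R → n ∈ Set.Icc (-⌈R⌉) ⌈R⌉ := by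
      intro n hn
      have h1 := abs_le.1 (hn.trans (Int.le_ceil R))
      exact ⟨by exact_mod_cast h1.1, by exact_mod_cast h1.2⟩
    refine ⟨fun i => hb _ ?_, fun i => hb _ ?_⟩
    · exact (norm_le_pi_norm (fun i => (g.1 i : ℝ)) i).trans ((norm_fst_le _).trans hmem)
    · exact (norm_le_pi_norm (fun i => (g.2 i : ℝ)) i).trans ((norm_snd_le _).trans hmem)

instance : LocallyCompactSpace totalSpace := totalSpace.isOpen.locallyCompactSpace

/-- The total space `𝒮` of the family of abelian surfaces: the quotient of `ℍ₂ × (ℂˣ)²` by `ℤ²` and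
by the integral translations of `ℍ₂`. It is a complex manifold of dimension five. -/
abbrev SurfaceFamily : Type := AddAction.orbitRel.Quotient PeriodGroup totalSpace

instance : IsManifold 𝓘(ℂ, (Fin 3 → ℂ) × (Fin 2 → ℂ)) ω SurfaceFamily :=
  isManifold_quotient contMDiff_vadd

/-- `Ψ(τ) = (t₁t₂, t₂t₃, t₂⁻¹)` with `t₁ = e(τ₁₁)`, `t₂ = e(τ₁₂)`, `t₃ = e(τ₂₂)`. It identifies the
quotient of `ℍ₂` by the integral translations with an open subset of `ℂ³`. -/
noncomputable def psi (t : Fin 3 → ℂ) : Fin 3 → ℂ :=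
  ![expTwoPiI (t 0) * expTwoPiI (t 1), expTwoPiI (t 1) * expTwoPiI (t 2), (expTwoPiI (t 1))⁻¹]

theorem psi_int_add (s : Fin 3 → ℤ) (t : Fin 3 → ℂ) :
    psi (fun i => (s i : ℂ) + t i) = psi t := by
  simp [psi, expTwoPiI_add, expTwoPiI_intCast]

/-- The projection of the family `𝒮` to its base, `[τ, w] ↦ Ψ(τ)`. -/
noncomputable def surfaceProj : SurfaceFamily → (Fin 3 → ℂ) :=
  Quotient.lift (fun p : totalSpace => psi p.1.1) (by
    rintro _ p ⟨g, rfl⟩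
    exact psi_int_add g.1 p.1.1)

/-! ### Complex tori, abelian subvarieties and exponents -/

/-- The lattice `Λ_τ = ℤ² + τℤ²`. -/
def periodLattice (t : Fin 3 → ℂ) : AddSubgroup (Fin 2 → ℂ) where
  carrier := {z | ∃ a b : Fin 2 → ℤ,
    z = (fun i => (a i : ℂ)) + symMat t *ᵥ (fun i => (b i : ℂ))}
  zero_mem' := ⟨0, 0, by ext i; fin_cases i <;> simp⟩
  add_mem' := by
    rintro _ _ ⟨a, b, rfl⟩ ⟨c, d, rfl⟩
    refine ⟨a + c, b + d, ?_⟩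
    have h : (fun i => (((b + d) i : ℤ) : ℂ)) = (fun i => (b i : ℂ)) + fun i => (d i : ℂ) := by
      ext i
      simp
    rw [h, Matrix.mulVec_add]
    ext i
    simp only [Pi.add_apply, Int.cast_add]
    ring
  neg_mem' := by
    rintro _ ⟨a, b, rfl⟩
    refine ⟨-a, -b, ?_⟩
    have h : (fun i => (((-b) i : ℤ) : ℂ)) = -(fun i => (b i : ℂ)) := by
      ext i
      simp
    rw [h, Matrix.mulVec_neg]
    ext i
    simp only [Pi.add_apply, Pi.neg_apply, Int.cast_neg]
    ring

/-- The abelian surface `A_τ = ℂ² / Λ_τ`. -/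
abbrev AbelianSurface (t : Fin 3 → ℂ) : Type := (Fin 2 → ℂ) ⧸ periodLattice t

/-- The principal polarization of `A_τ`, as the Riemann form `E = Im H` on `ℂ²` of the Hermitian
form `H(z, z') = zᵗ (Im τ)⁻¹ conj(z')`. -/
noncomputable def riemannForm (t : Fin 3 → ℂ) (z z' : Fin 2 → ℂ) : ℝ :=
  (z ⬝ᵥ (((imMat t)⁻¹).map ((↑) : ℝ → ℂ) *ᵥ star z')).im

theorem riemannForm_add_left (t : Fin 3 → ℂ) (x y z : Fin 2 → ℂ) :
    riemannForm t (x + y) z = riemannForm t x z + riemannForm t y z := by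
  simp [riemannForm, add_dotProduct]

theorem riemannForm_neg_left (t : Fin 3 → ℂ) (x z : Fin 2 → ℂ) :
    riemannForm t (-x) z = -riemannForm t x z := by
  simp [riemannForm]

/-- The lattice `Λ_τ ∩ W` of the subtorus `W / (Λ_τ ∩ W)`. -/
def latticeIn (t : Fin 3 → ℂ) (W : Submodule ℂ (Fin 2 → ℂ)) : AddSubgroup (Fin 2 → ℂ) :=
  periodLattice t ⊓ W.toAddSubgroup

/-- The vectors of `W` whose pairing with every element of the lattice `Λ_τ ∩ W` is an integer. The
quotient of this group by `Λ_τ ∩ W` is the kernel of the polarization `L|_Z`, that is, of the map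
`Z → Pic⁰(Z)` for `Z = W / (Λ_τ ∩ W)`, where `L` is the principal polarization of `A_τ`. -/
noncomputable def dualLatticeIn (t : Fin 3 → ℂ) (W : Submodule ℂ (Fin 2 → ℂ)) :
    AddSubgroup (Fin 2 → ℂ) where
  carrier := {z | z ∈ W ∧ ∀ l ∈ latticeIn t W, ∃ n : ℤ, riemannForm t z l = n}
  zero_mem' := ⟨W.zero_mem, fun l _ => ⟨0, by simp [riemannForm]⟩⟩
  add_mem' := by
    rintro x y ⟨hx, hx2⟩ ⟨hy, hy2⟩
    refine ⟨W.add_mem hx hy, fun l hl => ?_⟩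
    obtain ⟨a, ha⟩ := hx2 l hl
    obtain ⟨b, hb⟩ := hy2 l hl
    exact ⟨a + b, by rw [riemannForm_add_left, ha, hb, Int.cast_add]⟩
  neg_mem' := by
    rintro x ⟨hx, hx2⟩
    refine ⟨W.neg_mem hx, fun l hl => ?_⟩
    obtain ⟨a, ha⟩ := hx2 l hl
    exact ⟨-a, by rw [riemannForm_neg_left, ha, Int.cast_neg]⟩

/-- The exponent of the abelian subvariety `Z = W / (Λ_τ ∩ W)` of `A_τ`: the exponent of the
polarization induced on `Z` by the principal polarization of `A_τ`, that is, the exponent of the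
finite group that is its kernel. -/
noncomputable def subvarietyExponent (t : Fin 3 → ℂ) (W : Submodule ℂ (Fin 2 → ℂ)) : ℕ :=
  AddMonoid.exponent (dualLatticeIn t W ⧸ (latticeIn t W).addSubgroupOf (dualLatticeIn t W))

/-- The image in `A_τ` of a complex linear subspace of `ℂ²`. -/
def imageInSurface (t : Fin 3 → ℂ) (W : Submodule ℂ (Fin 2 → ℂ)) :
    AddSubgroup (AbelianSurface t) :=
  W.toAddSubgroup.map (QuotientAddGroup.mk' (periodLattice t))

/-- `Z` is an abelian subvariety of exponent `n` of `A_τ`: the image of a complex linear subspace `W`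
in which `Λ_τ ∩ W` is a full lattice, for which the induced polarization has exponent `n`. -/
def IsAbelianSubvarietyOfExponent (t : Fin 3 → ℂ) (Z : AddSubgroup (AbelianSurface t)) (n : ℕ) :
    Prop :=
  ∃ W : Submodule ℂ (Fin 2 → ℂ),
    Submodule.span ℝ (latticeIn t W : Set (Fin 2 → ℂ)) = W.restrictScalars ℝ ∧
    Z = imageInSurface t W ∧ subvarietyExponent t W = n

/-- The identification of `A_τ` with the fibre of `𝒮` over `Ψ(τ)`, induced by
`z ↦ [τ, (e(z₁), e(z₂))]`. -/
noncomputable def fibreMap (t : Fin 3 → ℂ) (ht : t ∈ siegel) : AbelianSurface t → SurfaceFamily :=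
  Quotient.lift
    (fun z : Fin 2 → ℂ => (Quotient.mk _ (⟨(t, fun i => expTwoPiI (z i)),
      ht, fun _ => expTwoPiI_ne_zero _⟩ : totalSpace) : SurfaceFamily)) (by
    intro x y hxy
    obtain ⟨a, b, hab⟩ := QuotientAddGroup.leftRel_apply.1 hxy
    refine (Quotient.sound (s := AddAction.orbitRel PeriodGroup totalSpace)
      ⟨((0 : Fin 3 → ℤ), b), ?_⟩).symm
    apply Subtype.ext
    refine Prod.ext ?_ ?_
    · simp [vadd_fst]
    · ext i
      have hi : y i = (symMat t *ᵥ (fun j => (b j : ℂ))) i + (x i + a i) := by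
        have := congrFun hab i
        simp only [Pi.add_apply, Pi.neg_apply] at this
        linear_combination this
      simp only [vadd_snd]
      rw [hi, expTwoPiI_add, expTwoPiI_add, expTwoPiI_intCast, mul_one])

theorem exists_int_of_expTwoPiI_eq {x y : ℂ} (h : expTwoPiI x = expTwoPiI y) :
    ∃ n : ℤ, x = n + y := by
  obtain ⟨n, hn⟩ := Complex.exp_eq_exp_iff_exists_int.1 h
  refine ⟨n, mul_left_cancel₀ Complex.two_pi_I_ne_zero ?_⟩
  rw [hn]
  ring

theorem fibreMap_injective (t : Fin 3 → ℂ) (ht : t ∈ siegel) :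
    Function.Injective (fibreMap t ht) := by
  intro x y
  induction x using QuotientAddGroup.induction_on with | H x => ?_
  induction y using QuotientAddGroup.induction_on with | H y => ?_
  intro h
  obtain ⟨g, hg⟩ := Quotient.exact h
  have hg2 := congrArg (fun p : totalSpace => p.1.2) hg
  simp only [vadd_snd, ← expTwoPiI_add] at hg2
  choose a ha using fun i => exists_int_of_expTwoPiI_eq (congrFun hg2 i)
  refine QuotientAddGroup.eq.2 ⟨a, -g.2, ?_⟩
  have hneg : (fun i => (((-g.2) i : ℤ) : ℂ)) = -(fun i => (g.2 i : ℂ)) := by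
    ext i
    simp
  rw [hneg, Matrix.mulVec_neg]
  ext i
  have := ha i
  simp only [Pi.add_apply, Pi.neg_apply]
  linear_combination this

theorem range_fibreMap (t : Fin 3 → ℂ) (ht : t ∈ siegel) :
    Set.range (fibreMap t ht) = surfaceProj ⁻¹' {psi t} := by
  ext q
  constructor
  · rintro ⟨x, rfl⟩
    induction x using QuotientAddGroup.induction_on with | H x => rfl
  · induction q using Quotient.inductionOn with | h p => ?_
    intro h
    have h' : psi p.1.1 = psi t := h
    have h1 : expTwoPiI (p.1.1 1) = expTwoPiI (t 1) := inv_injective (congrFun h' 2)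
    have h0 : expTwoPiI (p.1.1 0) = expTwoPiI (t 0) := by
      have : expTwoPiI (p.1.1 0) * expTwoPiI (p.1.1 1) = expTwoPiI (t 0) * expTwoPiI (t 1) :=
        congrFun h' 0
      rw [h1] at this
      exact mul_right_cancel₀ (expTwoPiI_ne_zero _) this
    have h2 : expTwoPiI (p.1.1 2) = expTwoPiI (t 2) := by
      have : expTwoPiI (p.1.1 1) * expTwoPiI (p.1.1 2) = expTwoPiI (t 1) * expTwoPiI (t 2) :=
        congrFun h' 1
      rw [h1] at this
      exact mul_left_cancel₀ (expTwoPiI_ne_zero _) this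
    have hall : ∀ i, expTwoPiI (p.1.1 i) = expTwoPiI (t i) := by
      intro i
      fin_cases i <;> assumption
    choose s hs using fun i => exists_int_of_expTwoPiI_eq (hall i)
    refine ⟨QuotientAddGroup.mk (fun i => Complex.log (p.1.2 i) / (2 * Real.pi * Complex.I)), ?_⟩
    refine (Quotient.sound (s := AddAction.orbitRel PeriodGroup totalSpace)
      ⟨(s, (0 : Fin 2 → ℤ)), ?_⟩).symm
    apply Subtype.ext
    refine Prod.ext ?_ ?_
    · ext i
      exact (hs i).symm
    · ext i
      have hz : (symMat t *ᵥ (fun j => (((0 : Fin 2 → ℤ) j : ℤ) : ℂ))) i = ((0 : ℤ) : ℂ) := by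
        simp only [Pi.zero_apply, Int.cast_zero, Matrix.mulVec, dotProduct, mul_zero,
          Finset.sum_const_zero]
      simp only [vadd_snd]
      rw [hz, expTwoPiI_intCast, one_mul, expTwoPiI, mul_div_cancel₀ _ Complex.two_pi_I_ne_zero,
        Complex.exp_log (p.2.2 i)]

/-! ### The families -/

/-- The indices `(c, e) ∈ ℕ²` with `gcd(m, c, e) = 1`, and `∞`. -/
inductive FamilyIndex (m : ℕ) : Type
  | pair (c e : ℕ) (h : Nat.gcd m (Nat.gcd c e) = 1) : FamilyIndex m
  | infty : FamilyIndex m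

/-- The period matrices over which the family of index `i` is defined. -/
def periodSet {m : ℕ} : FamilyIndex m → Set (Fin 3 → ℂ)
  | .pair c e _ => {t | t ∈ siegel ∧ ∃ u v : ℂ, t = ![u, -((c * v + e) / m), v]}
  | .infty => {t | t ∈ siegel ∧ ∃ v z : ℂ, t = ![v, z, 1 / (m - 1) * (v - (m - 2) * z)]}

/-- The base `O_i ⊆ ℂ³`. -/
def baseSet {m : ℕ} (i : FamilyIndex m) : Set (Fin 3 → ℂ) := psi '' periodSet i

/-- The restriction `𝒮_i` of the family `𝒮` to `O_i`. -/
def restrictedFamily {m : ℕ} (i : FamilyIndex m) : Set SurfaceFamily := surfaceProj ⁻¹' baseSet i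

/-- The line `⟨(1, 0)⟩` for `i = (c, e)`, and `⟨(-1, 1)⟩` for `i = ∞`. -/
def lineOf {m : ℕ} : FamilyIndex m → Submodule ℂ (Fin 2 → ℂ)
  | .pair _ _ _ => Submodule.span ℂ {![1, 0]}
  | .infty => Submodule.span ℂ {![-1, 1]}

/-- The fibre of `π : K → ℂ³` over `T`, as a complex analytic space, is an elliptic curve: there is a
holomorphic immersion `ℂ → K` that identifies a torus `ℂ / (ℤ + ℤσ)`, with `Im σ > 0`, with the set
`π⁻¹(T)`, and the tangent space `ker dπ` of the analytic fibre is at each point the tangent line of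
this curve (so that the analytic fibre is reduced and smooth). -/
def IsEllipticCurveFibre {K : Type} [TopologicalSpace K] [ChartedSpace (Fin 3 → ℂ) K]
    (proj : K → (Fin 3 → ℂ)) (T : Fin 3 → ℂ) : Prop :=
  ∃ (s : UpperHalfPlane) (j : ℂ → K),
    ContMDiff 𝓘(ℂ) 𝓘(ℂ, Fin 3 → ℂ) ω j ∧
    Set.range j = proj ⁻¹' {T} ∧
    (∀ x y : ℂ, j x = j y ↔ ∃ a b : ℤ, x - y = a + b * (s : ℂ)) ∧
    (∀ x : ℂ, Function.Injective (mfderiv 𝓘(ℂ) 𝓘(ℂ, Fin 3 → ℂ) j x)) ∧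
    ∀ (x : ℂ) (v : TangentSpace 𝓘(ℂ, Fin 3 → ℂ) (j x)),
      mfderiv 𝓘(ℂ, Fin 3 → ℂ) 𝓘(ℂ, Fin 3 → ℂ) proj (j x) v = 0 ↔
        v ∈ Set.range (mfderiv 𝓘(ℂ) 𝓘(ℂ, Fin 3 → ℂ) j x)

end SplitSurfaces

/-!
The two kinds of families are instances of one construction. Both are families of period matrices
`τ(x)`, affine in two parameters `(x₀, x₁)` with an integral linear part that has an integral left
inverse, and both satisfy a relation `τ b = σ l + k` with integral vectors `b`, `l`, `k` and a
modulus `σ` that is affine in the parameters: `τ (m, c) = σ (1, 0) + (0, -e)` for the index `(c,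
e)`, and `τ (-1, m - 1) = σ (-1, 1)` for `∞`. A `SplitDatum` records this.

The relation decides the lattice on the line `ℂ l`. Taking imaginary parts, `(Im τ) b = (Im σ) l`,
so that `Im σ > 0`, and every lattice vector on `ℂ l` has a `τ`-part that is a real multiple of
`b`; since `gcd(b₁, b₂, k₁l₂ - k₂l₁) = 1`, the multiple is an integer, and `Λ_τ ∩ ℂ l = ℤ l + ℤ
σl` (`IsSplitPeriod.mem_latticeIn_iff`). The condition `gcd(m, c, e) = 1` is used exactly here.
The Riemann form takes the value `±(l · b) = ±m` on the two generators, so that the kernel of the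
induced polarization is `m⁻¹L / L` for this lattice `L`, of exponent `m`
(`IsSplitPeriod.subvarietyExponent_eq`). All of this is stable under `τ ↦ τ + S`
(`IsSplitPeriod.int_add`), hence holds for every `τ` over a given point of `ℂ³`.

The total space of the elliptic curves is the quotient of the points `(x₀, x₁, w)` with `τ(x)` in
the Siegel space and `w ∈ ℂˣ` by `ℤ² × ℤ`, which translates the parameters by integers and
multiplies `w` by powers of `e(σ(x))`. The embedding `(x, w) ↦ (τ(x), (w ^ l₁, w ^ l₂))` into `ℍ₂
× (ℂˣ)²` is equivariant for an injective homomorphism to `Sym(2, ℤ) × ℤ²`, so that freeness and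
proper discontinuity are inherited, and the embedding descends to a map to the family of abelian
surfaces. Two members of the family of period matrices have the same image under `Ψ` only if their
parameters differ by integers; hence the fibre over `Ψ(τ(x))` is the single curve `ℂ / (ℤ +
ℤσ(x))` (`SplitDatum.isEllipticCurveFibre`), and it maps injectively to `A_τ` because `Λ_τ ∩ ℂ l =
ℤ l + ℤ σl`. The quotient maps are local biholomorphisms (`isLocalDiffeomorph_quotientMk`), so
that every assertion on differentials reduces to one about explicit maps between open subsets of
vector spaces: the embedding has a holomorphic left inverse, and `Ψ ∘ τ` has the `w`-direction as
the kernel of its differential.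
-/

namespace SplitSurfaces

/-! ### Quotient maps and open subsets as local biholomorphisms -/

/-- The quotient map of a free, properly discontinuous, holomorphic action is a local
biholomorphism: it is a translation followed by a chart of the total space and by the inverse of the
chart of the quotient that this chart induces. -/
theorem isLocalDiffeomorph_quotientMk {E : Type*} [NormedAddCommGroup E] [NormedSpace ℂ E]
    {M : Type*} [TopologicalSpace M] [ChartedSpace E M] [IsManifold 𝓘(ℂ, E) ω M]
    {G : Type*} [AddGroup G] [AddAction G M]
    [ProperlyDiscontinuousVAdd G M] [ContinuousConstVAdd G M] [IsCancelVAdd G M]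
    [T2Space M] [LocallyCompactSpace M]
    (hG : ∀ g : G, ContMDiff 𝓘(ℂ, E) 𝓘(ℂ, E) ω (fun x : M => g +ᵥ x)) :
    IsLocalDiffeomorph 𝓘(ℂ, E) 𝓘(ℂ, E) ω
      (Quotient.mk (AddAction.orbitRel G M) : M → AddAction.orbitRel.Quotient G M) := by
  have hman : IsManifold 𝓘(ℂ, E) ω (AddAction.orbitRel.Quotient G M) := isManifold_quotient hG
  have hloc : IsLocalHomeomorph (Quotient.mk (AddAction.orbitRel G M)) :=
    (isAddQuotientCoveringMap_quotientMk_of_properlyDiscontinuousVAdd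
      (G := G) (E := M)).isCoveringMap.isLocalHomeomorph
  intro a
  set q : AddAction.orbitRel.Quotient G M := Quotient.mk _ a with hq
  obtain ⟨b, hb, hchart⟩ : ∃ b : M, Quotient.mk (AddAction.orbitRel G M) b = q ∧
      chartAt E q = (hloc.localInverseAt b).trans (chartAt E b) :=
    ⟨_, (Quotient.mk_surjective (s := AddAction.orbitRel G M)).hasRightInverse.choose_spec q, rfl⟩
  obtain ⟨g, hg⟩ : ∃ g : G, g +ᵥ a = b := Quotient.exact hb
  let D : Diffeomorph 𝓘(ℂ, E) 𝓘(ℂ, E) M M ω :=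
    { toEquiv := AddAction.toPerm g
      contMDiff_toFun := hG g
      contMDiff_invFun := hG (-g) }
  let C : PartialDiffeomorph 𝓘(ℂ, E) 𝓘(ℂ, E) M E ω :=
    { toPartialEquiv := (chartAt E b).toPartialEquiv
      open_source := (chartAt E b).open_source
      open_target := (chartAt E b).open_target
      contMDiffOn_toFun := contMDiffOn_chart
      contMDiffOn_invFun := contMDiffOn_chart_symm }
  let Q : PartialDiffeomorph 𝓘(ℂ, E) 𝓘(ℂ, E) E (AddAction.orbitRel.Quotient G M) ω :=
    { toPartialEquiv := (chartAt E q).symm.toPartialEquiv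
      open_source := (chartAt E q).open_target
      open_target := (chartAt E q).open_source
      contMDiffOn_toFun := contMDiffOn_chart_symm
      contMDiffOn_invFun := contMDiffOn_chart }
  have hQ : ∀ v, Q v = Quotient.mk _ ((chartAt E b).symm v) := by
    intro v
    change (chartAt E q).symm v = _
    rw [hchart]
    simp
  have hsrc : ∀ x, x ∈ (((D.toPartialDiffeomorph).trans C).trans Q).source ↔
      g +ᵥ x ∈ (chartAt E b).source ∧ chartAt E b (g +ᵥ x) ∈ (chartAt E q).target := by
    intro x
    change (x ∈ Set.univ ∩ _) ∧ _ ↔ _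
    rw [Set.univ_inter]
    rfl
  refine ⟨(D.toPartialDiffeomorph.trans C).trans Q, (hsrc a).2 ?_, fun x hx => ?_⟩
  · rw [hg]
    refine ⟨mem_chart_source E b, ?_⟩
    rw [hchart]
    simp [mem_chart_source E b]
  · change _ = Q (chartAt E b (g +ᵥ x))
    rw [hQ, (chartAt E b).left_inv ((hsrc x).1 hx).1]
    exact (Quotient.sound ⟨g, rfl⟩ : Quotient.mk (AddAction.orbitRel G M) _ = _).symm

/-- A map out of a manifold is holomorphic if its composition with a surjective local biholomorphism
is. -/
theorem contMDiff_of_comp_isLocalDiffeomorph {E F : Type*} [NormedAddCommGroup E] [NormedSpace ℂ E]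
    [NormedAddCommGroup F] [NormedSpace ℂ F]
    {M : Type*} [TopologicalSpace M] [ChartedSpace E M]
    {N : Type*} [TopologicalSpace N] [ChartedSpace E N]
    {P : Type*} [TopologicalSpace P] [ChartedSpace F P]
    {p : M → N} (hp : IsLocalDiffeomorph 𝓘(ℂ, E) 𝓘(ℂ, E) ω p) (hs : Function.Surjective p)
    {f : N → P} (hf : ContMDiff 𝓘(ℂ, E) 𝓘(ℂ, F) ω (f ∘ p)) : ContMDiff 𝓘(ℂ, E) 𝓘(ℂ, F) ω f := by
  intro y
  obtain ⟨x, rfl⟩ := hs y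
  have hloc := hp x
  have h1 : ContMDiffAt 𝓘(ℂ, E) 𝓘(ℂ, F) ω ((f ∘ p) ∘ hloc.localInverse) (p x) :=
    hf.contMDiffAt.comp _ hloc.localInverse_contMDiffAt
  refine h1.congr_of_eventuallyEq ?_
  filter_upwards [hloc.localInverse_eventuallyEq_right] with z hz
  exact (congrArg f hz).symm

theorem bijective_mfderiv_of_isLocalDiffeomorph {E : Type*} [NormedAddCommGroup E] [NormedSpace ℂ E]
    {M : Type*} [TopologicalSpace M] [ChartedSpace E M] [IsManifold 𝓘(ℂ, E) ω M]
    {N : Type*} [TopologicalSpace N] [ChartedSpace E N] [IsManifold 𝓘(ℂ, E) ω N]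
    {p : M → N} (hp : IsLocalDiffeomorph 𝓘(ℂ, E) 𝓘(ℂ, E) ω p) (x : M) :
    Function.Bijective (mfderiv 𝓘(ℂ, E) 𝓘(ℂ, E) p x) :=
  ((hp x).mfderivToContinuousLinearEquiv (by simp)).bijective

/-- In the charts of an open subset of a normed space the inclusion is the identity. -/
theorem hasMFDerivAt_subtypeVal {E : Type*} [NormedAddCommGroup E] [NormedSpace ℂ E]
    {U : TopologicalSpace.Opens E} (x : U) :
    HasMFDerivAt 𝓘(ℂ, E) 𝓘(ℂ, E) (Subtype.val : U → E) x (ContinuousLinearMap.id ℂ E) := by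
  refine ⟨continuous_subtype_val.continuousAt, ?_⟩
  have h := U.chartAt_subtype_val_symm_eventuallyEq (H := E) (x := x)
  simp only [writtenInExtChartAt, mfld_simps, chartAt_self_eq] at h ⊢
  have hd : HasFDerivAt (Subtype.val ∘ (chartAt E x).symm) (ContinuousLinearMap.id ℂ E) (x : E) :=
    (hasFDerivAt_id _).congr_of_eventuallyEq h.symm
  exact hd.hasFDerivWithinAt

theorem mfderiv_subtypeVal_comp {E F : Type*} [NormedAddCommGroup E] [NormedSpace ℂ E]
    [NormedAddCommGroup F] [NormedSpace ℂ F] {M : Type*} [TopologicalSpace M] [ChartedSpace F M]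
    {U : TopologicalSpace.Opens E} {f : M → U} {x : M}
    (hf : MDifferentiableAt 𝓘(ℂ, F) 𝓘(ℂ, E) f x) (v : TangentSpace 𝓘(ℂ, F) x) :
    mfderiv 𝓘(ℂ, F) 𝓘(ℂ, E) (fun y => (f y : E)) x v = mfderiv 𝓘(ℂ, F) 𝓘(ℂ, E) f x v := by
  have := ((hasMFDerivAt_subtypeVal (f x)).comp x hf.hasMFDerivAt).mfderiv
  exact DFunLike.congr_fun this v

theorem mfderiv_comp_subtypeVal {E F : Type*} [NormedAddCommGroup E] [NormedSpace ℂ E]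
    [NormedAddCommGroup F] [NormedSpace ℂ F]
    {U : TopologicalSpace.Opens E} {f : E → F} (x : U)
    (hf : DifferentiableAt ℂ f x) (v : TangentSpace 𝓘(ℂ, E) x) :
    mfderiv 𝓘(ℂ, E) 𝓘(ℂ, F) (fun y : U => f y) x v = fderiv ℂ f x v := by
  have := ((hf.hasFDerivAt.hasMFDerivAt).comp x (hasMFDerivAt_subtypeVal x)).mfderiv
  exact DFunLike.congr_fun this v

theorem contMDiff_of_subtypeVal_comp {E F : Type*} [NormedAddCommGroup E] [NormedSpace ℂ E]
    [NormedAddCommGroup F] [NormedSpace ℂ F] {M : Type*} [TopologicalSpace M] [ChartedSpace F M]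
    {U : TopologicalSpace.Opens E} {f : M → U}
    (hf : ContMDiff 𝓘(ℂ, F) 𝓘(ℂ, E) ω (fun y => (f y : E))) :
    ContMDiff 𝓘(ℂ, F) 𝓘(ℂ, E) ω f :=
  fun x => (ChartedSpace.liftPropWithinAt_subtypeVal_comp_iff ..).1 (hf x)

/-! ### The subtorus cut out by a line with integral relations -/

/-- The relations `τ b = σ l + k` with `b, l, k` integral that make the line `ℂ l` meet the lattice
`Λ_τ` in `ℤ l + ℤ σl`. The primitivity of `l` is witnessed by an integral linear form; the condition
`gcd(b₁, b₂, k₁l₂ - k₂l₁) = 1` says that no proper fraction of `b` satisfies such a relation modulo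
multiples of `l`. The intersection number of `l` and `σl` is `l₁b₁ + l₂b₂ = m`. -/
structure IsSplitPeriod (m : ℕ) (t : Fin 3 → ℂ) (l b k : Fin 2 → ℤ) (σ : ℂ) : Prop where
  mem_siegel : t ∈ siegel
  relation : ∀ i, (symMat t *ᵥ (fun j => (b j : ℂ))) i = σ * l i + k i
  primitive : ∃ r : Fin 2 → ℤ, r 0 * l 0 + r 1 * l 1 = 1
  coprime : ∃ x y z : ℤ, x * b 0 + y * b 1 + z * (k 0 * l 1 - k 1 * l 0) = 1
  pairing : l 0 * b 0 + l 1 * b 1 = m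
  pos : 0 < m

/-- Membership in the lattice `ℤ + ℤσ`. -/
def IsLatticePoint (σ : ℂ) (x : ℂ) : Prop := ∃ a n : ℤ, x = a + n * σ

/-- The vector `x l`. -/
def lineVec (l : Fin 2 → ℤ) (x : ℂ) : Fin 2 → ℂ := fun i => x * l i

theorem mem_span_lineVec {l : Fin 2 → ℤ} {z : Fin 2 → ℂ} :
    z ∈ Submodule.span ℂ {(fun i => (l i : ℂ))} ↔ ∃ x, z = lineVec l x := by
  rw [Submodule.mem_span_singleton]
  exact ⟨fun ⟨x, hx⟩ => ⟨x, hx.symm⟩, fun ⟨x, hx⟩ => ⟨x, hx.symm⟩⟩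

namespace IsSplitPeriod

variable {m : ℕ} {t : Fin 3 → ℂ} {l b k : Fin 2 → ℤ} {σ : ℂ}

theorem lineVec_injective (h : IsSplitPeriod m t l b k σ) : Function.Injective (lineVec l) := by
  intro x y hxy
  obtain ⟨r, hr⟩ := h.primitive
  have hr' : (r 0 : ℂ) * l 0 + r 1 * l 1 = 1 := by exact_mod_cast hr
  have h0 : x * l 0 = y * l 0 := congrFun hxy 0
  have h1 : x * l 1 = y * l 1 := congrFun hxy 1
  linear_combination (r 0 : ℂ) * h0 + (r 1 : ℂ) * h1 - (x - y) * hr'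

theorem relation_zero (h : IsSplitPeriod m t l b k σ) :
    t 0 * b 0 + t 1 * b 1 = σ * l 0 + k 0 := by
  simpa [symMat, Matrix.mulVec, dotProduct, Fin.sum_univ_two] using h.relation 0

theorem relation_one (h : IsSplitPeriod m t l b k σ) :
    t 1 * b 0 + t 2 * b 1 = σ * l 1 + k 1 := by
  simpa [symMat, Matrix.mulVec, dotProduct, Fin.sum_univ_two] using h.relation 1

theorem im_relation_zero (h : IsSplitPeriod m t l b k σ) :
    (t 0).im * b 0 + (t 1).im * b 1 = σ.im * l 0 := by
  simpa using congrArg Complex.im h.relation_zero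

theorem im_relation_one (h : IsSplitPeriod m t l b k σ) :
    (t 1).im * b 0 + (t 2).im * b 1 = σ.im * l 1 := by
  simpa using congrArg Complex.im h.relation_one

/-- Pairing `(Im τ) b = (Im σ) l` with `b` gives `m Im σ = bᵗ (Im τ) b > 0`. -/
theorem im_pos (h : IsSplitPeriod m t l b k σ) : 0 < σ.im := by
  obtain ⟨h0, hD⟩ := (mem_siegel_iff t).1 h.mem_siegel
  have e0 := h.im_relation_zero
  have e1 := h.im_relation_one
  have hm : (0 : ℝ) < m := by exact_mod_cast h.pos
  have hp : (l 0 : ℝ) * b 0 + l 1 * b 1 = m := by exact_mod_cast h.pairing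
  have key : (t 0).im * (m * σ.im) = ((t 0).im * b 0 + (t 1).im * b 1) ^ 2 +
      ((t 0).im * (t 2).im - (t 1).im ^ 2) * (b 1 : ℝ) ^ 2 := by
    rw [← hp]
    linear_combination (-(t 0).im * b 0) * e0 - (t 0).im * b 1 * e1
  have hpos : 0 < (t 0).im * (m * σ.im) := by
    rw [key]
    by_cases hb : (b 1 : ℝ) = 0
    · have hb0 : (b 0 : ℝ) ≠ 0 := by
        intro hb0
        rw [hb, hb0] at hp
        simp at hp
        exact hm.ne hp
      have : 0 < ((t 0).im * b 0) ^ 2 := by positivity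
      simpa [hb] using this
    · have : 0 < (b 1 : ℝ) ^ 2 := by positivity
      have := mul_pos hD this
      positivity
  exact pos_of_mul_pos_right (pos_of_mul_pos_right hpos h0.le) hm.le

theorem lineVec_mem_periodLattice (h : IsSplitPeriod m t l b k σ) (a n : ℤ) :
    lineVec l (a + n * σ) ∈ periodLattice t := by
  refine ⟨fun i => a * l i - n * k i, fun i => n * b i, ?_⟩
  have e0 := h.relation_zero
  have e1 := h.relation_one
  ext i
  fin_cases i
  · simp [lineVec, symMat, dotProduct, Fin.sum_univ_two]
    linear_combination -(n : ℂ) * e0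
  · simp [lineVec, symMat, dotProduct, Fin.sum_univ_two]
    linear_combination -(n : ℂ) * e1

/-- The imaginary part of `x l = a + τ b'` forces `b'` to be a real multiple `ρ b` of `b`; then the
coprimality condition makes `ρ` an integer, and `a + ρ k` an integral multiple of `l`. -/
theorem isLatticePoint_of_mem (h : IsSplitPeriod m t l b k σ) {x : ℂ}
    (hx : lineVec l x ∈ periodLattice t) : IsLatticePoint σ x := by
  obtain ⟨a, b', hab⟩ := hx
  have hσ := h.im_pos
  obtain ⟨h0, hD⟩ := (mem_siegel_iff t).1 h.mem_siegel
  have e0 := h.relation_zero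
  have e1 := h.relation_one
  have i0 := h.im_relation_zero
  have i1 := h.im_relation_one
  have f0 : x * l 0 = a 0 + (t 0 * b' 0 + t 1 * b' 1) := by
    simpa [lineVec, symMat, Matrix.mulVec, dotProduct, Fin.sum_univ_two] using congrFun hab 0
  have f1 : x * l 1 = a 1 + (t 1 * b' 0 + t 2 * b' 1) := by
    simpa [lineVec, symMat, Matrix.mulVec, dotProduct, Fin.sum_univ_two] using congrFun hab 1
  have j0 : x.im * l 0 = (t 0).im * b' 0 + (t 1).im * b' 1 := by
    simpa using congrArg Complex.im f0
  have j1 : x.im * l 1 = (t 1).im * b' 0 + (t 2).im * b' 1 := by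
    simpa using congrArg Complex.im f1
  obtain ⟨ρ, hρ⟩ : ∃ ρ : ℝ, ρ * σ.im = x.im := ⟨x.im / σ.im, div_mul_cancel₀ _ hσ.ne'⟩
  -- Cramer's rule: `(Im τ) b' = (Im x) l = ρ (Im τ) b` and `Im τ` is invertible.
  have hb0 : (b' 0 : ℝ) = ρ * b 0 := by
    refine mul_left_cancel₀ hD.ne' ?_
    linear_combination (t 1).im * j1 - (t 2).im * j0 + ρ * ((t 1).im * i1 - (t 2).im * i0)
      + ((t 1).im * l 1 - (t 2).im * l 0) * hρ
  have hb1 : (b' 1 : ℝ) = ρ * b 1 := by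
    refine mul_left_cancel₀ hD.ne' ?_
    linear_combination (t 1).im * j0 - (t 0).im * j1 + ρ * ((t 1).im * i0 - (t 0).im * i1)
      + ((t 1).im * l 0 - (t 0).im * l 1) * hρ
  have hb0' : (b' 0 : ℂ) = ρ * b 0 := by exact_mod_cast congrArg (Complex.ofReal) hb0
  have hb1' : (b' 1 : ℂ) = ρ * b 1 := by exact_mod_cast congrArg (Complex.ofReal) hb1
  -- `a + ρ k = (x - ρ σ) l` is a multiple of `l`.
  have hcross : (a 0 : ℂ) * l 1 - a 1 * l 0 = -ρ * (k 0 * l 1 - k 1 * l 0) := by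
    rw [hb0', hb1'] at f0 f1
    linear_combination -(l 1 : ℂ) * f0 + (l 0 : ℂ) * f1 - ρ * l 1 * e0 + ρ * l 0 * e1
  obtain ⟨p, q, s, hpqs⟩ := h.coprime
  have hpqs' : (p : ℂ) * b 0 + q * b 1 + s * (k 0 * l 1 - k 1 * l 0) = 1 := by
    exact_mod_cast hpqs
  -- The Bézout relation for `b₁, b₂, k₁l₂ - k₂l₁`, multiplied by `ρ`, is an integer.
  set n : ℤ := p * b' 0 + q * b' 1 - s * (a 0 * l 1 - a 1 * l 0) with hn
  have hn' : (n : ℂ) = ρ := by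
    rw [hn]
    push_cast
    rw [hb0', hb1', hcross]
    linear_combination (ρ : ℂ) * hpqs'
  obtain ⟨r, hr⟩ := h.primitive
  have hr' : (r 0 : ℂ) * l 0 + r 1 * l 1 = 1 := by exact_mod_cast hr
  refine ⟨r 0 * (a 0 + n * k 0) + r 1 * (a 1 + n * k 1), n, ?_⟩
  rw [hb0', hb1', ← hn'] at f0 f1
  push_cast
  linear_combination -x * hr' + (r 0 : ℂ) * f0 + (r 1 : ℂ) * f1 + r 0 * n * e0 + r 1 * n * e1
    + n * σ * hr'

theorem mem_latticeIn_iff (h : IsSplitPeriod m t l b k σ) {z : Fin 2 → ℂ} :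
    z ∈ latticeIn t (Submodule.span ℂ {(fun i => (l i : ℂ))}) ↔
      ∃ x, z = lineVec l x ∧ IsLatticePoint σ x := by
  constructor
  · rintro ⟨hz, hz2⟩
    obtain ⟨x, rfl⟩ := mem_span_lineVec.1 hz2
    exact ⟨x, rfl, h.isLatticePoint_of_mem hz⟩
  · rintro ⟨x, rfl, a, n, rfl⟩
    exact ⟨h.lineVec_mem_periodLattice a n, mem_span_lineVec.2 ⟨_, rfl⟩⟩

theorem exists_real_combination (h : IsSplitPeriod m t l b k σ) (x : ℂ) :
    ∃ α ρ : ℝ, x = α + ρ * σ := by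
  have hσ := h.im_pos.ne'
  refine ⟨x.re - x.im / σ.im * σ.re, x.im / σ.im, Complex.ext ?_ ?_⟩
  · simp
  · simp [div_mul_cancel₀ _ hσ]

/-- The line `ℂ l` is the real span of `l` and `σl`, so that its image is a subtorus. -/
theorem span_latticeIn (h : IsSplitPeriod m t l b k σ) :
    Submodule.span ℝ
      (latticeIn t (Submodule.span ℂ {(fun i => (l i : ℂ))}) : Set (Fin 2 → ℂ)) =
      (Submodule.span ℂ {(fun i => (l i : ℂ))}).restrictScalars ℝ := by
  apply le_antisymm
  · exact Submodule.span_le.2 fun z hz => hz.2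
  · intro z hz
    obtain ⟨x, rfl⟩ := mem_span_lineVec.1 hz
    obtain ⟨α, ρ, rfl⟩ := h.exists_real_combination x
    have h1 : lineVec l (α + ρ * σ) = α • lineVec l 1 + ρ • lineVec l σ := by
      ext i
      simp [lineVec]
      ring
    rw [h1]
    refine Submodule.add_mem _ (Submodule.smul_mem _ _ (Submodule.subset_span ?_))
      (Submodule.smul_mem _ _ (Submodule.subset_span ?_))
    · exact h.mem_latticeIn_iff.2 ⟨1, rfl, 1, 0, by simp⟩
    · exact h.mem_latticeIn_iff.2 ⟨σ, rfl, 0, 1, by simp⟩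

/-- On the line `ℂ l` the Riemann form is `(x, y) ↦ m Im(x ȳ) / Im σ`, because
`(Im τ)⁻¹ l = b / Im σ`. -/
theorem riemannForm_lineVec (h : IsSplitPeriod m t l b k σ) (x y : ℂ) :
    riemannForm t (lineVec l x) (lineVec l y) * σ.im = m * (x * star y).im := by
  have hσ := h.im_pos
  have hdet : IsUnit (imMat t).det :=
    (Matrix.isUnit_iff_isUnit_det _).1 (Matrix.PosDef.isUnit h.mem_siegel)
  have hb : imMat t *ᵥ (fun j => (b j : ℝ)) = σ.im • (fun i => (l i : ℝ)) := by
    ext i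
    fin_cases i
    · simpa [imMat, symMat, Matrix.mulVec, dotProduct, Fin.sum_univ_two] using h.im_relation_zero
    · simpa [imMat, symMat, Matrix.mulVec, dotProduct, Fin.sum_univ_two] using h.im_relation_one
  have hinv : σ.im • ((imMat t)⁻¹ *ᵥ (fun i => (l i : ℝ))) = fun j => (b j : ℝ) := by
    rw [← Matrix.mulVec_smul, ← hb, Matrix.mulVec_mulVec, Matrix.nonsing_inv_mul _ hdet,
      Matrix.one_mulVec]
  have g0 := congrFun hinv 0
  have g1 := congrFun hinv 1
  have hp : (l 0 : ℝ) * b 0 + l 1 * b 1 = m := by exact_mod_cast h.pairing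
  rw [← hp, ← g0, ← g1]
  simp [riemannForm, lineVec, Matrix.mulVec, dotProduct, Fin.sum_univ_two]
  ring

theorem mem_dualLatticeIn_iff (h : IsSplitPeriod m t l b k σ) {z : Fin 2 → ℂ} :
    z ∈ dualLatticeIn t (Submodule.span ℂ {(fun i => (l i : ℂ))}) ↔
      ∃ x, z = lineVec l x ∧ IsLatticePoint σ (m * x) := by
  have hσ := h.im_pos
  constructor
  · rintro ⟨hz, hz2⟩
    obtain ⟨x, rfl⟩ := mem_span_lineVec.1 hz
    obtain ⟨α, ρ, rfl⟩ := h.exists_real_combination x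
    obtain ⟨n, hn⟩ := hz2 _ (h.mem_latticeIn_iff.2 ⟨1, rfl, 1, 0, by simp⟩)
    obtain ⟨a, ha⟩ := hz2 _ (h.mem_latticeIn_iff.2 ⟨σ, rfl, 0, 1, by simp⟩)
    have e1 := h.riemannForm_lineVec (α + ρ * σ) 1
    have e2 := h.riemannForm_lineVec (α + ρ * σ) σ
    rw [hn] at e1
    rw [ha] at e2
    simp at e1 e2
    have h1 : (m : ℝ) * ρ = n := by
      refine mul_right_cancel₀ hσ.ne' ?_
      linear_combination -e1
    have h2 : (m : ℝ) * α = -a := by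
      refine mul_right_cancel₀ hσ.ne' ?_
      linear_combination e2
    have h1' : (m : ℂ) * ρ = n := by exact_mod_cast congrArg Complex.ofReal h1
    have h2' : (m : ℂ) * α = -a := by exact_mod_cast congrArg Complex.ofReal h2
    refine ⟨_, rfl, -a, n, ?_⟩
    push_cast
    linear_combination h2' + σ * h1'
  · rintro ⟨x, rfl, a, n, hx⟩
    refine ⟨mem_span_lineVec.2 ⟨_, rfl⟩, fun z hz => ?_⟩
    obtain ⟨_, rfl, c, d, rfl⟩ := h.mem_latticeIn_iff.1 hz
    refine ⟨n * c - a * d, mul_right_cancel₀ hσ.ne' ?_⟩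
    rw [h.riemannForm_lineVec]
    have : (m : ℝ) * (x * star (c + d * σ)).im = ((m * x) * star (c + d * σ)).im := by
      simp [mul_add]
      ring
    rw [this, hx]
    simp
    ring

/-- The kernel of the induced polarization is `m⁻¹L / L` with `L = ℤ l + ℤ σl`, which has exponent
`m`. -/
theorem subvarietyExponent_eq (h : IsSplitPeriod m t l b k σ) :
    subvarietyExponent t (Submodule.span ℂ {(fun i => (l i : ℂ))}) = m := by
  have hm : (m : ℂ) ≠ 0 := by exact_mod_cast h.pos.ne'
  have hσ := h.im_pos
  have hsmul : ∀ (n : ℕ) (x : ℂ), n • lineVec l x = lineVec l (n * x) := by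
    intro n x
    ext i
    simp [lineVec, mul_assoc]
  refine Nat.dvd_antisymm ?_ ?_
  · refine AddMonoid.exponent_dvd_of_forall_nsmul_eq_zero fun q => ?_
    induction q using QuotientAddGroup.induction_on with | H z => ?_
    obtain ⟨x, hx, hL⟩ := h.mem_dualLatticeIn_iff.1 z.2
    rw [← QuotientAddGroup.mk_nsmul, QuotientAddGroup.eq_zero_iff, AddSubgroup.mem_addSubgroupOf]
    refine h.mem_latticeIn_iff.2 ⟨m * x, ?_, hL⟩
    rw [← hsmul, ← hx]
    rfl
  · -- The class of `l / m` has order `m`.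
    have hz : lineVec l (1 / m) ∈ dualLatticeIn t (Submodule.span ℂ {(fun i => (l i : ℂ))}) :=
      h.mem_dualLatticeIn_iff.2 ⟨_, rfl, 1, 0, by simp [hm]⟩
    have h0 := AddMonoid.exponent_nsmul_eq_zero
      (QuotientAddGroup.mk
        (s := (latticeIn t (Submodule.span ℂ {(fun i => (l i : ℂ))})).addSubgroupOf
          (dualLatticeIn t (Submodule.span ℂ {(fun i => (l i : ℂ))}))) ⟨_, hz⟩)
    rw [← QuotientAddGroup.mk_nsmul, QuotientAddGroup.eq_zero_iff,
      AddSubgroup.mem_addSubgroupOf] at h0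
    change subvarietyExponent t (Submodule.span ℂ {(fun i => (l i : ℂ))}) • lineVec l (1 / m) ∈ _
      at h0
    rw [hsmul] at h0
    obtain ⟨x, hx, a, n, rfl⟩ := h.mem_latticeIn_iff.1 h0
    have hx' := h.lineVec_injective hx
    generalize subvarietyExponent t (Submodule.span ℂ {(fun i => (l i : ℂ))}) = e at hx'
    have hn : n = 0 := by
      have := congrArg Complex.im hx'
      rw [mul_one_div, ← Complex.ofReal_natCast, ← Complex.ofReal_natCast,
        ← Complex.ofReal_div, Complex.ofReal_im] at this
      simpa [hσ.ne'] using this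
    rw [hn] at hx'
    have : (e : ℂ) = m * a := by
      field_simp at hx'
      simpa using hx'
    have : (e : ℤ) = m * a := by exact_mod_cast this
    exact Int.natCast_dvd_natCast.1 ⟨a, this⟩

theorem isAbelianSubvarietyOfExponent (h : IsSplitPeriod m t l b k σ) :
    IsAbelianSubvarietyOfExponent t
      (imageInSurface t (Submodule.span ℂ {(fun i => (l i : ℂ))})) m :=
  ⟨_, h.span_latticeIn, rfl, h.subvarietyExponent_eq⟩

end IsSplitPeriod

/-! ### Integral translations of period matrices -/

theorem hasDerivAt_expTwoPiI (x : ℂ) :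
    HasDerivAt expTwoPiI (2 * Real.pi * Complex.I * expTwoPiI x) x := by
  have := ((hasDerivAt_id x).const_mul (2 * Real.pi * Complex.I)).cexp
  rw [mul_one, mul_comm (Complex.exp _)] at this
  exact this

theorem expTwoPiI_int_mul (n : ℤ) (x : ℂ) : expTwoPiI (n * x) = expTwoPiI x ^ n := by
  rw [expTwoPiI, expTwoPiI, ← Complex.exp_int_mul]
  ring_nf

theorem exists_expTwoPiI_eq {w : ℂ} (hw : w ≠ 0) : ∃ z, expTwoPiI z = w := by
  refine ⟨Complex.log w / (2 * Real.pi * Complex.I), ?_⟩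
  rw [expTwoPiI, mul_div_cancel₀ _ Complex.two_pi_I_ne_zero, Complex.exp_log hw]

theorem exists_int_of_psi_eq {t t' : Fin 3 → ℂ} (h : psi t = psi t') :
    ∃ s : Fin 3 → ℤ, t = fun i => (s i : ℂ) + t' i := by
  have h1 : expTwoPiI (t 1) = expTwoPiI (t' 1) := inv_injective (congrFun h 2)
  have h0 : expTwoPiI (t 0) = expTwoPiI (t' 0) := by
    have : expTwoPiI (t 0) * expTwoPiI (t 1) = expTwoPiI (t' 0) * expTwoPiI (t' 1) := congrFun h 0
    rw [h1] at this
    exact mul_right_cancel₀ (expTwoPiI_ne_zero _) this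
  have h2 : expTwoPiI (t 2) = expTwoPiI (t' 2) := by
    have : expTwoPiI (t 1) * expTwoPiI (t 2) = expTwoPiI (t' 1) * expTwoPiI (t' 2) := congrFun h 1
    rw [h1] at this
    exact mul_left_cancel₀ (expTwoPiI_ne_zero _) this
  have hall : ∀ i, expTwoPiI (t i) = expTwoPiI (t' i) := by
    intro i
    fin_cases i <;> assumption
  choose s hs using fun i => exists_int_of_expTwoPiI_eq (hall i)
  exact ⟨s, funext hs⟩

/-- Under `τ ↦ τ + S` the relation `τ b = σ l + k` becomes `(τ + S) b = σ l + (k + S b)`. -/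
theorem IsSplitPeriod.int_add {m : ℕ} {t : Fin 3 → ℂ} {l b k : Fin 2 → ℤ} {σ : ℂ}
    (h : IsSplitPeriod m t l b k σ) (s : Fin 3 → ℤ) :
    IsSplitPeriod m (fun i => (s i : ℂ) + t i) l b
      ![k 0 + (s 0 * b 0 + s 1 * b 1), k 1 + (s 1 * b 0 + s 2 * b 1)] σ where
  mem_siegel := add_int_mem_siegel h.mem_siegel s
  relation i := by
    have e0 := h.relation_zero
    have e1 := h.relation_one
    fin_cases i
    · simp [symMat, Matrix.mulVec, dotProduct, Fin.sum_univ_two]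
      linear_combination e0
    · simp [symMat, Matrix.mulVec, dotProduct, Fin.sum_univ_two]
      linear_combination e1
  primitive := h.primitive
  coprime := by
    obtain ⟨x, y, z, hxyz⟩ := h.coprime
    refine ⟨x - z * (l 1 * s 0 - l 0 * s 1), y - z * (l 1 * s 1 - l 0 * s 2), z, ?_⟩
    simp
    linear_combination hxyz
  pairing := h.pairing
  pos := h.pos

theorem contDiffAt_zpow (n : ℤ) {w : ℂ} (hw : w ≠ 0) : ContDiffAt ℂ ω (fun z : ℂ => z ^ n) w := by
  cases n with
  | ofNat n =>
    simp only [Int.ofNat_eq_natCast, zpow_natCast]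
    fun_prop
  | negSucc n =>
    simp only [zpow_negSucc]
    exact ContDiffAt.inv (by fun_prop) (pow_ne_zero _ hw)

/-! ### The family of elliptic curves of a split datum -/

/-- Integral data for a two-parameter family of period matrices `τ(x) = base + lin (x₀, x₁)` with
the integral relations `τ(x) b = σ(x) l + k`, where `σ(x) = sigma₀ + slope · (x₀, x₁)`. The matrix
`lin` has an integral left inverse, so that two members of the family differ by an integral matrix
only if their parameters differ by integers. -/
structure SplitDatum (m : ℕ) where
  /-- The constant term of the family of period matrices. -/
  base : Fin 3 → ℂ
  /-- The linear part of the family of period matrices. -/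
  lin : Fin 3 → Fin 2 → ℤ
  /-- An integral left inverse of the linear part. -/
  inv : Fin 2 → Fin 3 → ℤ
  /-- A primitive integral vector that spans the line. -/
  l : Fin 2 → ℤ
  /-- An integral linear form with value `1` at `l`. -/
  r : Fin 2 → ℤ
  /-- The coefficients of `τ` in the second generator of the lattice on the line. -/
  b : Fin 2 → ℤ
  /-- The integral translation in the relation. -/
  k : Fin 2 → ℤ
  /-- The constant term of the modulus of the elliptic curves. -/
  sigma₀ : ℂ
  /-- The linear part of the modulus of the elliptic curves. -/
  slope : Fin 2 → ℤ
  pos : 0 < m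
  inv_lin : ∀ i j, inv i 0 * lin 0 j + inv i 1 * lin 1 j + inv i 2 * lin 2 j =
    if i = j then 1 else 0
  r_l : r 0 * l 0 + r 1 * l 1 = 1
  coprime : ∃ x y z : ℤ, x * b 0 + y * b 1 + z * (k 0 * l 1 - k 1 * l 0) = 1
  pairing : l 0 * b 0 + l 1 * b 1 = m
  relation_zero : ∀ x y : ℂ, (base 0 + lin 0 0 * x + lin 0 1 * y) * b 0 +
    (base 1 + lin 1 0 * x + lin 1 1 * y) * b 1 = (sigma₀ + slope 0 * x + slope 1 * y) * l 0 + k 0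
  relation_one : ∀ x y : ℂ, (base 1 + lin 1 0 * x + lin 1 1 * y) * b 0 +
    (base 2 + lin 2 0 * x + lin 2 1 * y) * b 1 = (sigma₀ + slope 0 * x + slope 1 * y) * l 1 + k 1

namespace SplitDatum

variable {m : ℕ} (D : SplitDatum m)

/-- The period matrix with parameters `(x₀, x₁)`; the third coordinate `x₂` is reserved for the
fibre. -/
def period (x : Fin 3 → ℂ) : Fin 3 → ℂ := fun i => D.base i + D.lin i 0 * x 0 + D.lin i 1 * x 1

/-- The modulus of the elliptic curve with parameters `(x₀, x₁)`. -/
def sigma (x : Fin 3 → ℂ) : ℂ := D.sigma₀ + D.slope 0 * x 0 + D.slope 1 * x 1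

/-- The linear part of the family of period matrices. -/
def linMap (u : Fin 3 → ℂ) : Fin 3 → ℂ := fun i => D.lin i 0 * u 0 + D.lin i 1 * u 1

theorem inv_linMap_zero (u : Fin 3 → ℂ) :
    D.inv 0 0 * D.linMap u 0 + D.inv 0 1 * D.linMap u 1 + D.inv 0 2 * D.linMap u 2 = u 0 := by
  have h0 := congrArg (Int.cast (R := ℂ)) (D.inv_lin 0 0)
  have h1 := congrArg (Int.cast (R := ℂ)) (D.inv_lin 0 1)
  simp at h0 h1
  simp only [linMap]
  linear_combination u 0 * h0 + u 1 * h1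

theorem inv_linMap_one (u : Fin 3 → ℂ) :
    D.inv 1 0 * D.linMap u 0 + D.inv 1 1 * D.linMap u 1 + D.inv 1 2 * D.linMap u 2 = u 1 := by
  have h0 := congrArg (Int.cast (R := ℂ)) (D.inv_lin 1 0)
  have h1 := congrArg (Int.cast (R := ℂ)) (D.inv_lin 1 1)
  simp at h0 h1
  simp only [linMap]
  linear_combination u 0 * h0 + u 1 * h1

theorem linMap_eq_zero_iff {u : Fin 3 → ℂ} : D.linMap u = 0 ↔ u 0 = 0 ∧ u 1 = 0 := by
  constructor
  · intro h
    have h0 := D.inv_linMap_zero u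
    have h1 := D.inv_linMap_one u
    simp only [h, Pi.zero_apply, mul_zero, add_zero] at h0 h1
    exact ⟨h0.symm, h1.symm⟩
  · rintro ⟨h0, h1⟩
    ext i
    simp [linMap, h0, h1]

theorem period_add (x u : Fin 3 → ℂ) (i : Fin 3) :
    D.period (x + u) i = D.period x i + D.linMap u i := by
  simp [period, linMap]
  ring

theorem exists_int_of_period_eq {x y : Fin 3 → ℂ} {s : Fin 3 → ℤ}
    (h : D.period x = fun i => (s i : ℂ) + D.period y i) :
    ∃ n : Fin 2 → ℤ, x 0 = y 0 + n 0 ∧ x 1 = y 1 + n 1 := by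
  have hs : ∀ i, D.linMap (x - y) i = s i := by
    intro i
    have h1 := D.period_add y (x - y) i
    rw [add_sub_cancel, h] at h1
    linear_combination -h1
  have h0 := D.inv_linMap_zero (x - y)
  have h1 := D.inv_linMap_one (x - y)
  simp only [hs, Pi.sub_apply] at h0 h1
  refine ⟨fun i => D.inv i 0 * s 0 + D.inv i 1 * s 1 + D.inv i 2 * s 2, ?_, ?_⟩
  · push_cast
    linear_combination -h0
  · push_cast
    linear_combination -h1

theorem isSplitPeriod {x : Fin 3 → ℂ} (hx : D.period x ∈ siegel) :
    IsSplitPeriod m (D.period x) D.l D.b D.k (D.sigma x) where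
  mem_siegel := hx
  relation i := by
    fin_cases i
    · simpa [symMat, Matrix.mulVec, dotProduct, Fin.sum_univ_two, period, sigma] using
        D.relation_zero (x 0) (x 1)
    · simpa [symMat, Matrix.mulVec, dotProduct, Fin.sum_univ_two, period, sigma] using
        D.relation_one (x 0) (x 1)
  primitive := ⟨D.r, D.r_l⟩
  coprime := D.coprime
  pairing := D.pairing
  pos := D.pos

theorem continuous_period : Continuous D.period := by
  unfold period
  fun_prop

/-- The parameters `(x₀, x₁)` of period matrices in the Siegel upper half space, together with a
coordinate `x₂ ∈ ℂˣ` on the line `ℂ l` modulo `ℤ l`. -/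
def space : TopologicalSpace.Opens (Fin 3 → ℂ) where
  carrier := {x | D.period x ∈ siegel ∧ x 2 ≠ 0}
  is_open' := by
    have hc := D.continuous_period
    simp only [mem_siegel_iff]
    refine IsOpen.inter (IsOpen.inter ?_ ?_) ?_
    · exact isOpen_lt continuous_const (Complex.continuous_im.comp ((continuous_apply 0).comp hc))
    · have him : ∀ i, Continuous fun x => (D.period x i).im :=
        fun i => Complex.continuous_im.comp ((continuous_apply i).comp hc)
      exact isOpen_lt continuous_const (((him 0).mul (him 2)).sub ((him 1).pow 2))
    · exact isOpen_ne_fun (by fun_prop) continuous_const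

/-- The group that acts on the parameters: integral translations of `(x₀, x₁)` and multiplication of
`x₂` by the powers of `e(σ(x))`. -/
abbrev Translations : Type := (Fin 2 → ℤ) × ℤ

/-- The homomorphism from the group of the datum to the group that acts on `ℍ₂ × (ℂˣ)²`. -/
def groupHom (g : Translations) : PeriodGroup :=
  (fun i => D.lin i 0 * g.1 0 + D.lin i 1 * g.1 1, fun i => g.2 * D.b i)

theorem groupHom_add (g h : Translations) : D.groupHom (g + h) = D.groupHom g + D.groupHom h := by
  refine Prod.ext ?_ ?_
  · ext i
    simp [groupHom]
    ring
  · ext i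
    simp [groupHom]
    ring

theorem groupHom_injective : Function.Injective D.groupHom := by
  intro g h hgh
  have h1 : ∀ i, D.lin i 0 * g.1 0 + D.lin i 1 * g.1 1 = D.lin i 0 * h.1 0 + D.lin i 1 * h.1 1 :=
    fun i => congrFun (congrArg Prod.fst hgh) i
  have h2 : ∀ i, g.2 * D.b i = h.2 * D.b i := fun i => congrFun (congrArg Prod.snd hgh) i
  have a0 := D.inv_lin 0 0
  have a1 := D.inv_lin 0 1
  have b0 := D.inv_lin 1 0
  have b1 := D.inv_lin 1 1
  simp at a0 a1 b0 b1
  refine Prod.ext ?_ ?_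
  · ext i
    fin_cases i
    · simp
      linear_combination D.inv 0 0 * h1 0 + D.inv 0 1 * h1 1 + D.inv 0 2 * h1 2
        - (g.1 0 - h.1 0) * a0 - (g.1 1 - h.1 1) * a1
    · simp
      linear_combination D.inv 1 0 * h1 0 + D.inv 1 1 * h1 1 + D.inv 1 2 * h1 2
        - (g.1 0 - h.1 0) * b0 - (g.1 1 - h.1 1) * b1
  · have hp := D.pairing
    have hm : (m : ℤ) ≠ 0 := by exact_mod_cast D.pos.ne'
    refine mul_right_cancel₀ hm ?_
    rw [← hp]
    linear_combination D.l 0 * h2 0 + D.l 1 * h2 1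

/-- The translate of a parameter point. -/
noncomputable def act (g : Translations) (x : Fin 3 → ℂ) : Fin 3 → ℂ :=
  ![x 0 + g.1 0, x 1 + g.1 1, expTwoPiI (g.2 * D.sigma x) * x 2]

theorem period_act (g : Translations) (x : Fin 3 → ℂ) :
    D.period (D.act g x) = fun i => ((D.groupHom g).1 i : ℂ) + D.period x i := by
  ext i
  simp [period, act, groupHom]
  ring

noncomputable instance : VAdd Translations D.space where
  vadd g x := ⟨D.act g x, by
    refine ⟨?_, mul_ne_zero (expTwoPiI_ne_zero _) x.2.2⟩
    rw [period_act]
    exact add_int_mem_siegel x.2.1 _⟩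

theorem coe_vadd (g : Translations) (x : D.space) :
    ((g +ᵥ x : D.space) : Fin 3 → ℂ) = D.act g x := rfl

/-- The equivariant embedding of the parameter space into `ℍ₂ × (ℂˣ)²`. -/
noncomputable def embed (x : D.space) : totalSpace :=
  ⟨(D.period x, fun i => (x : Fin 3 → ℂ) 2 ^ D.l i), x.2.1, fun _ => zpow_ne_zero _ x.2.2⟩

theorem embed_vadd (g : Translations) (x : D.space) :
    D.embed (g +ᵥ x) = D.groupHom g +ᵥ D.embed x := by
  apply Subtype.ext
  refine Prod.ext ?_ ?_
  · exact D.period_act g x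
  · ext i
    rw [vadd_snd]
    change (expTwoPiI (g.2 * D.sigma x) * (x : Fin 3 → ℂ) 2) ^ D.l i = _ * (x : Fin 3 → ℂ) 2 ^ D.l i
    have hrel := (D.isSplitPeriod x.2.1).relation i
    have hmul : (symMat (D.embed x).1.1 *ᵥ fun j => (((D.groupHom g).2 j : ℤ) : ℂ)) i =
        D.l i * (g.2 * D.sigma x) + ((g.2 * D.k i : ℤ) : ℂ) := by
      have hb : (fun j => (((D.groupHom g).2 j : ℤ) : ℂ)) = (g.2 : ℂ) • fun j => (D.b j : ℂ) := by
        ext j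
        simp [groupHom]
      rw [hb, Matrix.mulVec_smul, Pi.smul_apply]
      change (g.2 : ℂ) • (symMat (D.period x) *ᵥ fun j => (D.b j : ℂ)) i = _
      rw [hrel, smul_eq_mul]
      push_cast
      ring
    rw [hmul, expTwoPiI_add, expTwoPiI_intCast, mul_one, mul_zpow,
      expTwoPiI_int_mul (D.l i)]

/-- A left inverse of the embedding of the parameter space. -/
noncomputable def retract (p : (Fin 3 → ℂ) × (Fin 2 → ℂ)) : Fin 3 → ℂ :=
  ![D.inv 0 0 * (p.1 0 - D.base 0) + D.inv 0 1 * (p.1 1 - D.base 1)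
      + D.inv 0 2 * (p.1 2 - D.base 2),
    D.inv 1 0 * (p.1 0 - D.base 0) + D.inv 1 1 * (p.1 1 - D.base 1)
      + D.inv 1 2 * (p.1 2 - D.base 2),
    p.2 0 ^ D.r 0 * p.2 1 ^ D.r 1]

theorem retract_embed (x : D.space) : D.retract (D.embed x) = x := by
  have hsub : ∀ i, D.period x i - D.base i = D.linMap x i := by
    intro i
    simp [period, linMap]
    ring
  have h0 := D.inv_linMap_zero x
  have h1 := D.inv_linMap_one x
  simp only [← hsub] at h0 h1
  ext i
  fin_cases i
  · exact h0
  · exact h1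
  · change ((x : Fin 3 → ℂ) 2 ^ D.l 0) ^ D.r 0 * ((x : Fin 3 → ℂ) 2 ^ D.l 1) ^ D.r 1 = _
    rw [← zpow_mul, ← zpow_mul, ← zpow_add₀ x.2.2, mul_comm (D.l 0), mul_comm (D.l 1), D.r_l,
      zpow_one]
    rfl

theorem embed_injective : Function.Injective D.embed := by
  intro x y h
  apply Subtype.ext
  rw [← D.retract_embed x, h, D.retract_embed]

theorem groupHom_zero : D.groupHom 0 = 0 := by
  have := D.groupHom_add 0 0
  rwa [add_zero, left_eq_add] at this

noncomputable instance : AddAction Translations D.space where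
  zero_vadd x := D.embed_injective (by rw [embed_vadd, groupHom_zero, zero_vadd])
  add_vadd g h x := D.embed_injective (by
    rw [embed_vadd, embed_vadd, embed_vadd, groupHom_add, add_vadd])

theorem contMDiff_vadd (g : Translations) :
    ContMDiff 𝓘(ℂ, Fin 3 → ℂ) 𝓘(ℂ, Fin 3 → ℂ) ω (fun x : D.space => g +ᵥ x) := by
  refine contMDiff_of_subtypeVal_comp ?_
  have hF : ContDiff ℂ ω (D.act g) := by
    refine contDiff_pi.2 fun i => ?_
    fin_cases i
    · change ContDiff ℂ ω fun x : Fin 3 → ℂ => x 0 + (g.1 0 : ℂ)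
      fun_prop
    · change ContDiff ℂ ω fun x : Fin 3 → ℂ => x 1 + (g.1 1 : ℂ)
      fun_prop
    · change ContDiff ℂ ω fun x : Fin 3 → ℂ => expTwoPiI (g.2 * D.sigma x) * x 2
      refine ContDiff.mul (contDiff_expTwoPiI.comp ?_) (by fun_prop)
      unfold sigma
      fun_prop
  exact hF.contMDiff.comp contMDiff_subtype_val

theorem contMDiff_embed :
    ContMDiff 𝓘(ℂ, Fin 3 → ℂ) 𝓘(ℂ, (Fin 3 → ℂ) × (Fin 2 → ℂ)) ω D.embed := by
  refine contMDiff_of_subtypeVal_comp fun x => ?_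
  have hF : ContDiffAt ℂ ω (fun y : Fin 3 → ℂ => (D.period y, fun i => y 2 ^ D.l i)) x := by
    refine ContDiffAt.prodMk ?_ (contDiffAt_pi.2 fun i => ?_)
    · unfold period
      fun_prop
    · exact (contDiffAt_zpow (D.l i) x.2.2).comp (x : Fin 3 → ℂ)
        (f := fun y : Fin 3 → ℂ => y 2) (by fun_prop)
  exact hF.contMDiffAt.comp x contMDiff_subtype_val.contMDiffAt

instance : ContinuousConstVAdd Translations D.space where
  continuous_const_vadd g := (D.contMDiff_vadd g).continuous

instance : IsCancelVAdd Translations D.space where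
  left_cancel' g p q h := by
    have := congrArg (fun x => -g +ᵥ x) h
    simpa using this
  right_cancel' g h p hgh := by
    have := congrArg D.embed hgh
    rw [embed_vadd, embed_vadd] at this
    exact D.groupHom_injective (IsCancelVAdd.right_cancel _ _ _ this)

/-- Proper discontinuity is inherited along the equivariant embedding. -/
instance : ProperlyDiscontinuousVAdd Translations D.space where
  finite_disjoint_inter_image := by
    intro K L hK hL
    have hc := D.contMDiff_embed.continuous
    have hfin := ProperlyDiscontinuousVAdd.finite_disjoint_inter_image (Γ := PeriodGroup)
      (hK.image hc) (hL.image hc)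
    refine (hfin.preimage D.groupHom_injective.injOn).subset ?_
    rintro g ⟨_, ⟨x, hx, rfl⟩, hq⟩
    exact ⟨D.embed (g +ᵥ x), ⟨D.embed x, ⟨x, hx, rfl⟩, (D.embed_vadd g x).symm⟩, ⟨_, hq, rfl⟩⟩

instance : LocallyCompactSpace D.space := D.space.isOpen.locallyCompactSpace

/-- The total space of the family of elliptic curves. -/
abbrev Curves : Type := AddAction.orbitRel.Quotient Translations D.space

instance : IsManifold 𝓘(ℂ, Fin 3 → ℂ) ω D.Curves := isManifold_quotient D.contMDiff_vadd

instance : SecondCountableTopology D.Curves :=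
  ContinuousConstVAdd.secondCountableTopology

instance : T2Space D.Curves :=
  t2Space_of_properlyDiscontinuousVAdd_of_t2Space

/-- The quotient map onto the total space of the family of elliptic curves. -/
noncomputable def toCurves (x : D.space) : D.Curves := Quotient.mk _ x

theorem isLocalDiffeomorph_toCurves :
    IsLocalDiffeomorph 𝓘(ℂ, Fin 3 → ℂ) 𝓘(ℂ, Fin 3 → ℂ) ω D.toCurves :=
  isLocalDiffeomorph_quotientMk D.contMDiff_vadd

theorem toCurves_surjective : Function.Surjective D.toCurves := Quotient.mk_surjective

theorem toCurves_eq_iff {x y : D.space} :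
    D.toCurves x = D.toCurves y ↔ ∃ g : Translations, g +ᵥ y = x :=
  ⟨fun h => Quotient.exact h, fun h => Quotient.sound h⟩

end SplitDatum

/-! ### The map to the family of abelian surfaces -/

namespace SplitDatum

variable {m : ℕ} (D : SplitDatum m)

/-- The quotient map onto the family of abelian surfaces. -/
noncomputable def toSurfaces (p : totalSpace) : SurfaceFamily := Quotient.mk _ p

theorem isLocalDiffeomorph_toSurfaces :
    IsLocalDiffeomorph 𝓘(ℂ, (Fin 3 → ℂ) × (Fin 2 → ℂ)) 𝓘(ℂ, (Fin 3 → ℂ) × (Fin 2 → ℂ)) ω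
      toSurfaces :=
  isLocalDiffeomorph_quotientMk SplitSurfaces.contMDiff_vadd

/-- The map from the family of elliptic curves to the family of abelian surfaces. -/
noncomputable def toFamily : D.Curves → SurfaceFamily :=
  Quotient.lift (fun x : D.space => toSurfaces (D.embed x)) (by
    rintro _ x ⟨g, rfl⟩
    refine Quotient.sound (s := AddAction.orbitRel PeriodGroup totalSpace) ⟨D.groupHom g, ?_⟩
    exact (D.embed_vadd g x).symm)

theorem toFamily_toCurves (x : D.space) : D.toFamily (D.toCurves x) = toSurfaces (D.embed x) := rfl

/-- The projection of the family of elliptic curves to `ℂ³`. -/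
noncomputable def proj (y : D.Curves) : Fin 3 → ℂ := surfaceProj (D.toFamily y)

theorem contMDiff_toFamily :
    ContMDiff 𝓘(ℂ, Fin 3 → ℂ) 𝓘(ℂ, (Fin 3 → ℂ) × (Fin 2 → ℂ)) ω D.toFamily :=
  contMDiff_of_comp_isLocalDiffeomorph D.isLocalDiffeomorph_toCurves D.toCurves_surjective
    (isLocalDiffeomorph_toSurfaces.contMDiff.comp D.contMDiff_embed)

theorem contDiff_psi_period : ContDiff ℂ ω (fun x => psi (D.period x)) := by
  have hp : ∀ i, ContDiff ℂ ω fun x => expTwoPiI (D.period x i) := by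
    intro i
    refine contDiff_expTwoPiI.comp ?_
    unfold period
    fun_prop
  refine contDiff_pi.2 fun i => ?_
  fin_cases i
  · exact (hp 0).mul (hp 1)
  · exact (hp 1).mul (hp 2)
  · exact (hp 1).inv fun x => expTwoPiI_ne_zero _

theorem contMDiff_proj : ContMDiff 𝓘(ℂ, Fin 3 → ℂ) 𝓘(ℂ, Fin 3 → ℂ) ω D.proj :=
  contMDiff_of_comp_isLocalDiffeomorph D.isLocalDiffeomorph_toCurves D.toCurves_surjective
    (D.contDiff_psi_period.contMDiff.comp contMDiff_subtype_val)

/-! ### Immersions -/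

/-- The embedding has the holomorphic left inverse `retract`. -/
theorem injective_mfderiv_embed (x : D.space) :
    Function.Injective
      (mfderiv 𝓘(ℂ, Fin 3 → ℂ) 𝓘(ℂ, (Fin 3 → ℂ) × (Fin 2 → ℂ)) D.embed x) := by
  have hR : DifferentiableAt ℂ D.retract (D.embed x).1 := by
    refine differentiableAt_pi.2 fun i => ?_
    have hz : ∀ i (n : ℤ), DifferentiableAt ℂ
        (fun p : (Fin 3 → ℂ) × (Fin 2 → ℂ) => p.2 i ^ n) (D.embed x).1 := by
      intro i n
      exact ((contDiffAt_zpow n ((D.embed x).2.2 i)).differentiableAt (by simp)).comp _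
        (f := fun p : (Fin 3 → ℂ) × (Fin 2 → ℂ) => p.2 i) (by fun_prop)
    fin_cases i
    · change DifferentiableAt ℂ (fun p : (Fin 3 → ℂ) × (Fin 2 → ℂ) =>
        D.inv 0 0 * (p.1 0 - D.base 0) + D.inv 0 1 * (p.1 1 - D.base 1)
          + D.inv 0 2 * (p.1 2 - D.base 2)) _
      fun_prop
    · change DifferentiableAt ℂ (fun p : (Fin 3 → ℂ) × (Fin 2 → ℂ) =>
        D.inv 1 0 * (p.1 0 - D.base 0) + D.inv 1 1 * (p.1 1 - D.base 1)
          + D.inv 1 2 * (p.1 2 - D.base 2)) _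
      fun_prop
    · exact (hz 0 _).mul (hz 1 _)
  have hE := (D.contMDiff_embed.mdifferentiable (by simp) x).hasMFDerivAt
  have h1 := (hR.hasFDerivAt.hasMFDerivAt).comp x ((hasMFDerivAt_subtypeVal (D.embed x)).comp x hE)
  have h2 : D.retract ∘ Subtype.val ∘ D.embed = (Subtype.val : D.space → (Fin 3 → ℂ)) :=
    funext D.retract_embed
  rw [h2] at h1
  have h3 := hasMFDerivAt_unique h1 (hasMFDerivAt_subtypeVal x)
  intro u v huv
  have hu := DFunLike.congr_fun h3 u
  have hv := DFunLike.congr_fun h3 v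
  have : (ContinuousLinearMap.id ℂ (Fin 3 → ℂ)) u = (ContinuousLinearMap.id ℂ (Fin 3 → ℂ)) v := by
    refine hu.symm.trans (Eq.trans ?_ hv)
    exact congrArg (fderiv ℂ D.retract (D.embed x).1) huv
  exact this

theorem injective_mfderiv_toFamily (y : D.Curves) :
    Function.Injective
      (mfderiv 𝓘(ℂ, Fin 3 → ℂ) 𝓘(ℂ, (Fin 3 → ℂ) × (Fin 2 → ℂ)) D.toFamily y) := by
  obtain ⟨x, rfl⟩ := D.toCurves_surjective y
  have h1 := mfderiv_comp x (D.contMDiff_toFamily.mdifferentiable (by simp) (D.toCurves x))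
    (D.isLocalDiffeomorph_toCurves.mdifferentiable (by simp) x)
  have h2 := mfderiv_comp x (isLocalDiffeomorph_toSurfaces.mdifferentiable (by simp) (D.embed x))
    (D.contMDiff_embed.mdifferentiable (by simp) x)
  have h3 : D.toFamily ∘ D.toCurves = toSurfaces ∘ D.embed := rfl
  rw [h3, h2] at h1
  refine Function.Injective.of_comp_right ?_
    (bijective_mfderiv_of_isLocalDiffeomorph D.isLocalDiffeomorph_toCurves x).2
  have h4 := congrArg DFunLike.coe h1
  refine Eq.mp (congrArg Function.Injective h4) ?_
  exact (bijective_mfderiv_of_isLocalDiffeomorph isLocalDiffeomorph_toSurfaces _).1.comp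
    (D.injective_mfderiv_embed x)

/-! ### Fibres -/

/-- The kernel of the differential of `Ψ(τ(x))` is the direction of the fibre coordinate `x₂`. -/
theorem fderiv_psi_period_eq_zero_iff (x u : Fin 3 → ℂ) :
    fderiv ℂ (fun x => psi (D.period x)) x u = 0 ↔ u 0 = 0 ∧ u 1 = 0 := by
  have hd := (D.contDiff_psi_period.differentiable (by simp) x).hasFDerivAt
  -- The value of the differential at `u` is the derivative along the line `x + z u`.
  have hline : HasDerivAt (fun z : ℂ => x + z • u) u 0 := by
    simpa using ((hasDerivAt_id (0 : ℂ)).smul_const u).const_add x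
  have hcomp : HasDerivAt (fun z : ℂ => psi (D.period (x + z • u)))
      (fderiv ℂ (fun x => psi (D.period x)) x u) 0 := by
    have hd0 : HasFDerivAt (fun x => psi (D.period x)) (fderiv ℂ (fun x => psi (D.period x)) x)
        (x + (0 : ℂ) • u) := by
      simpa using hd
    exact hd0.comp_hasDerivAt (0 : ℂ) hline
  have hper : ∀ i, HasDerivAt (fun z : ℂ => D.period (x + z • u) i) (D.linMap u i) 0 := by
    intro i
    have h1 : (fun z : ℂ => D.period (x + z • u) i) =
        fun z => D.period x i + z * D.linMap u i := by
      ext z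
      rw [period_add]
      simp [linMap]
      ring
    rw [h1]
    simpa using ((hasDerivAt_id (0 : ℂ)).mul_const (D.linMap u i)).const_add (D.period x i)
  set ε : Fin 3 → ℂ := fun i => expTwoPiI (D.period x i) with hε
  have hε0 : ∀ i, ε i ≠ 0 := fun i => expTwoPiI_ne_zero _
  have hexp : ∀ i, HasDerivAt (fun z : ℂ => expTwoPiI (D.period (x + z • u) i))
      (2 * Real.pi * Complex.I * ε i * D.linMap u i) 0 := by
    intro i
    have he : HasDerivAt expTwoPiI (2 * Real.pi * Complex.I * ε i)
        (D.period (x + (0 : ℂ) • u) i) := by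
      simpa [hε] using hasDerivAt_expTwoPiI (D.period x i)
    exact HasDerivAt.comp (h₂ := expTwoPiI) (h := fun z : ℂ => D.period (x + z • u) i) 0 he (hper i)
  have hc := hasDerivAt_pi.1 hcomp
  have e0 := (hc 0).unique ((hexp 0).mul (hexp 1))
  have e1 := (hc 1).unique ((hexp 1).mul (hexp 2))
  have e2 := (hc 2).unique ((hexp 1).inv (expTwoPiI_ne_zero _))
  simp only [zero_smul, add_zero] at e0 e1 e2
  have hpi := Complex.two_pi_I_ne_zero
  rw [← D.linMap_eq_zero_iff]
  constructor
  · intro h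
    rw [h] at e0 e1 e2
    have h1 : D.linMap u 1 = 0 := by
      have := e2.symm
      simpa [hε0, hpi, expTwoPiI_ne_zero] using this
    have h0 : D.linMap u 0 = 0 := by
      have := e0.symm
      rw [h1] at this
      simpa [hε0, hpi, expTwoPiI_ne_zero] using this
    have h2 : D.linMap u 2 = 0 := by
      have := e1.symm
      rw [h1] at this
      simpa [hε0, hpi, expTwoPiI_ne_zero] using this
    ext i
    fin_cases i <;> assumption
  · intro h
    rw [h] at e0 e1 e2
    ext i
    fin_cases i
    · exact e0.trans (by simp)
    · exact e1.trans (by simp)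
    · exact e2.trans (by simp)

/-- The parametrization `z ↦ (x₀, x₁, e(z))` of a line of the parameter space. -/
noncomputable def curveLift (x : D.space) (z : ℂ) : D.space :=
  ⟨![(x : Fin 3 → ℂ) 0, (x : Fin 3 → ℂ) 1, expTwoPiI z], x.2.1, expTwoPiI_ne_zero _⟩

theorem contMDiff_curveLift (x : D.space) :
    ContMDiff 𝓘(ℂ) 𝓘(ℂ, Fin 3 → ℂ) ω (D.curveLift x) := by
  refine contMDiff_of_subtypeVal_comp (ContDiff.contMDiff (contDiff_pi.2 fun i => ?_))
  fin_cases i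
  · exact contDiff_const
  · exact contDiff_const
  · exact contDiff_expTwoPiI

theorem mfderiv_curveLift (x : D.space) (z h : ℂ) :
    mfderiv 𝓘(ℂ) 𝓘(ℂ, Fin 3 → ℂ) (D.curveLift x) z h =
      ![0, 0, 2 * Real.pi * Complex.I * expTwoPiI z * h] := by
  have h1 : HasDerivAt (fun z => (D.curveLift x z : Fin 3 → ℂ))
      ![0, 0, 2 * Real.pi * Complex.I * expTwoPiI z] z := by
    refine hasDerivAt_pi.2 fun i => ?_
    fin_cases i
    · exact hasDerivAt_const _ _
    · exact hasDerivAt_const _ _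
    · exact hasDerivAt_expTwoPiI z
  have h2 := mfderiv_subtypeVal_comp ((D.contMDiff_curveLift x).mdifferentiable (by simp) z) h
  refine h2.symm.trans ?_
  rw [mfderiv_eq_fderiv, h1.hasFDerivAt.fderiv]
  refine funext fun i => ?_
  change (h • ![0, 0, 2 * Real.pi * Complex.I * expTwoPiI z] : Fin 3 → ℂ) i = _
  fin_cases i <;> simp [mul_comm]

/-- The parametrization of the fibre through `x`. -/
noncomputable def curve (x : D.space) (z : ℂ) : D.Curves := D.toCurves (D.curveLift x z)

theorem contMDiff_curve (x : D.space) : ContMDiff 𝓘(ℂ) 𝓘(ℂ, Fin 3 → ℂ) ω (D.curve x) :=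
  D.isLocalDiffeomorph_toCurves.contMDiff.comp (D.contMDiff_curveLift x)

theorem mfderiv_curve (x : D.space) (z h : ℂ) :
    mfderiv 𝓘(ℂ) 𝓘(ℂ, Fin 3 → ℂ) (D.curve x) z h =
      mfderiv 𝓘(ℂ, Fin 3 → ℂ) 𝓘(ℂ, Fin 3 → ℂ) D.toCurves (D.curveLift x z)
        (mfderiv 𝓘(ℂ) 𝓘(ℂ, Fin 3 → ℂ) (D.curveLift x) z h) := by
  have := mfderiv_comp z
    (D.isLocalDiffeomorph_toCurves.mdifferentiable (by simp) (D.curveLift x z))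
    ((D.contMDiff_curveLift x).mdifferentiable (by simp) z)
  exact DFunLike.congr_fun this h

theorem mfderiv_proj_toCurves (x : D.space) (u : Fin 3 → ℂ) :
    mfderiv 𝓘(ℂ, Fin 3 → ℂ) 𝓘(ℂ, Fin 3 → ℂ) D.proj (D.toCurves x)
      (mfderiv 𝓘(ℂ, Fin 3 → ℂ) 𝓘(ℂ, Fin 3 → ℂ) D.toCurves x u) =
      fderiv ℂ (fun x => psi (D.period x)) x u := by
  have h1 := mfderiv_comp x (D.contMDiff_proj.mdifferentiable (by simp) (D.toCurves x))
    (D.isLocalDiffeomorph_toCurves.mdifferentiable (by simp) x)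
  have h2 := mfderiv_comp_subtypeVal x (D.contDiff_psi_period.differentiable (by simp) x) u
  exact (DFunLike.congr_fun h1 u).symm.trans h2

theorem curve_eq_iff (x : D.space) (z z' : ℂ) :
    D.curve x z = D.curve x z' ↔ ∃ a n : ℤ, z - z' = a + n * D.sigma x := by
  rw [curve, curve, toCurves_eq_iff]
  constructor
  · rintro ⟨g, hg⟩
    have h2 : expTwoPiI (g.2 * D.sigma x) * expTwoPiI z' = expTwoPiI z :=
      congrFun (congrArg Subtype.val hg) 2
    rw [← expTwoPiI_add] at h2
    obtain ⟨a, ha⟩ := exists_int_of_expTwoPiI_eq h2.symm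
    exact ⟨a, g.2, by linear_combination ha⟩
  · rintro ⟨a, n, h⟩
    refine ⟨(0, n), Subtype.ext ?_⟩
    rw [coe_vadd]
    have h2 : expTwoPiI (n * D.sigma x) * expTwoPiI z' = expTwoPiI z := by
      rw [← expTwoPiI_add, show z = a + (n * D.sigma x + z') by linear_combination h,
        expTwoPiI_add (a : ℂ), expTwoPiI_intCast, one_mul]
    ext i
    fin_cases i
    · simp [act, curveLift]
    · simp [act, curveLift]
    · exact h2

theorem range_curve (x : D.space) : Set.range (D.curve x) = D.proj ⁻¹' {psi (D.period x)} := by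
  ext y
  constructor
  · rintro ⟨z, rfl⟩
    rfl
  · -- Points over `Ψ(τ(x))` have integrally shifted parameters, which a translation brings back.
    intro hy
    obtain ⟨y, rfl⟩ := D.toCurves_surjective y
    obtain ⟨s, hs⟩ := exists_int_of_psi_eq (show psi (D.period y) = psi (D.period x) from hy)
    obtain ⟨n, h0, h1⟩ := D.exists_int_of_period_eq hs
    obtain ⟨z, hz⟩ := exists_expTwoPiI_eq y.2.2
    refine ⟨z, (D.toCurves_eq_iff.2 ⟨(n, 0), Subtype.ext ?_⟩).symm⟩
    rw [coe_vadd]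
    have h00 := expTwoPiI_intCast 0
    ext i
    fin_cases i
    · simp [act, curveLift, h0]
    · simp [act, curveLift, h1]
    · simp_all [act, curveLift]

theorem isEllipticCurveFibre (x : D.space) :
    IsEllipticCurveFibre D.proj (psi (D.period x)) := by
  have hpi := Complex.two_pi_I_ne_zero
  have hbij := fun z => bijective_mfderiv_of_isLocalDiffeomorph D.isLocalDiffeomorph_toCurves
    (D.curveLift x z)
  refine ⟨⟨D.sigma x, (D.isSplitPeriod x.2.1).im_pos⟩, D.curve x, D.contMDiff_curve x,
    D.range_curve x, D.curve_eq_iff x, fun z (h h' : ℂ) hh => ?_, fun z v => ?_⟩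
  · have h1 := (D.mfderiv_curve x z h).symm.trans (hh.trans (D.mfderiv_curve x z h'))
    have h2 := (hbij z).1 h1
    have h3 := (D.mfderiv_curveLift x z h).symm.trans (h2.trans (D.mfderiv_curveLift x z h'))
    exact mul_left_cancel₀ (M₀ := ℂ) (mul_ne_zero hpi (expTwoPiI_ne_zero z)) (congrFun h3 2)
  · obtain ⟨(u : Fin 3 → ℂ), rfl⟩ := (hbij z).2 v
    have hk := D.fderiv_psi_period_eq_zero_iff (D.curveLift x z) u
    have hp := D.mfderiv_proj_toCurves (D.curveLift x z) u
    refine Iff.trans (Eq.congr_left hp) (hk.trans ?_)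
    constructor
    · rintro ⟨h0, h1⟩
      refine ⟨(u 2 / (2 * Real.pi * Complex.I * expTwoPiI z) : ℂ), ?_⟩
      refine (D.mfderiv_curve x z _).trans (congrArg _ ((D.mfderiv_curveLift x z _).trans ?_))
      refine funext fun i => ?_
      fin_cases i
      · exact h0.symm
      · exact h1.symm
      · exact mul_div_cancel₀ _ (mul_ne_zero hpi (expTwoPiI_ne_zero z))
    · rintro ⟨h, hh⟩
      have h1 := (hbij z).1 ((D.mfderiv_curve x z h).symm.trans hh)
      have h2 := (D.mfderiv_curveLift x z h).symm.trans h1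
      exact ⟨(congrFun h2 0).symm, (congrFun h2 1).symm⟩

end SplitDatum

/-! ### Images of the fibres in the abelian surfaces -/

/-- The identification of `A_τ` with a fibre of `𝒮` does not change under `τ ↦ τ + S`. -/
theorem fibreMap_mk_eq_of_psi_eq {t t' : Fin 3 → ℂ} (ht : t ∈ siegel) (ht' : t' ∈ siegel)
    (h : psi t = psi t') (z : Fin 2 → ℂ) :
    fibreMap t ht (QuotientAddGroup.mk z) = fibreMap t' ht' (QuotientAddGroup.mk z) := by
  obtain ⟨s, rfl⟩ := exists_int_of_psi_eq h
  refine Quotient.sound (s := AddAction.orbitRel PeriodGroup totalSpace) ⟨(s, 0), ?_⟩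
  apply Subtype.ext
  refine Prod.ext rfl ?_
  have h00 := expTwoPiI_intCast 0
  ext i
  simp only [vadd_snd]
  fin_cases i <;> simp_all [symMat, Matrix.mulVec, dotProduct]

namespace SplitDatum

variable {m : ℕ} (D : SplitDatum m)

/-- The line `ℂ l`. -/
def line : Submodule ℂ (Fin 2 → ℂ) := Submodule.span ℂ {(fun i => (D.l i : ℂ))}

theorem toFamily_curve (x : D.space) (z : ℂ) :
    D.toFamily (D.curve x z) =
      fibreMap (D.period x) x.2.1 (QuotientAddGroup.mk (lineVec D.l z)) := by
  have h : D.embed (D.curveLift x z) = ⟨(D.period x, fun i => expTwoPiI (lineVec D.l z i)),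
      x.2.1, fun _ => expTwoPiI_ne_zero _⟩ := by
    apply Subtype.ext
    refine Prod.ext rfl (funext fun i => ?_)
    change expTwoPiI z ^ D.l i = expTwoPiI (z * D.l i)
    rw [mul_comm, expTwoPiI_int_mul]
  rw [curve, toFamily_toCurves, h]
  rfl

theorem injOn_toFamily (x : D.space) :
    Set.InjOn D.toFamily (D.proj ⁻¹' {psi (D.period x)}) := by
  rw [← D.range_curve x]
  rintro _ ⟨z, rfl⟩ _ ⟨z', rfl⟩ h
  rw [toFamily_curve, toFamily_curve] at h
  have h1 := QuotientAddGroup.eq.1 (fibreMap_injective _ _ h).symm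
  have h2 : -lineVec D.l z' + lineVec D.l z = lineVec D.l (z - z') := by
    ext i
    simp [lineVec]
    ring
  rw [h2] at h1
  exact (D.curve_eq_iff x z z').2 ((D.isSplitPeriod x.2.1).isLatticePoint_of_mem h1)

theorem image_toFamily (x : D.space) {t : Fin 3 → ℂ} (ht : t ∈ siegel)
    (h : psi t = psi (D.period x)) :
    D.toFamily '' (D.proj ⁻¹' {psi (D.period x)}) =
      fibreMap t ht '' (imageInSurface t D.line : Set (AbelianSurface t)) := by
  rw [← D.range_curve x]
  ext q
  constructor
  · rintro ⟨_, ⟨z, rfl⟩, rfl⟩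
    rw [toFamily_curve, ← fibreMap_mk_eq_of_psi_eq ht x.2.1 h]
    exact ⟨_, ⟨_, mem_span_lineVec.2 ⟨z, rfl⟩, rfl⟩, rfl⟩
  · rintro ⟨_, ⟨w, hw, rfl⟩, rfl⟩
    obtain ⟨z, rfl⟩ := mem_span_lineVec.1 hw
    refine ⟨_, ⟨z, rfl⟩, ?_⟩
    rw [toFamily_curve, ← fibreMap_mk_eq_of_psi_eq ht x.2.1 h]
    rfl

theorem isAbelianSubvarietyOfExponent (x : D.space) {t : Fin 3 → ℂ}
    (h : psi t = psi (D.period x)) :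
    IsAbelianSubvarietyOfExponent t (imageInSurface t D.line) m := by
  obtain ⟨s, rfl⟩ := exists_int_of_psi_eq h
  exact ((D.isSplitPeriod x.2.1).int_add s).isAbelianSubvarietyOfExponent

/-! ### The two types of families -/

/-- The datum for the index `(c, e)`, where `c' / m'` is the reduced form of `c / m`. The period
matrices are parametrized by `τ₁₁ = x₀` and `τ₂₂ = m' x₁`, so that `τ₁₂ = -c' x₁ - e / m` has
integral slope. The relation is `τ (m, c) = σ (1, 0) + (0, -e)` with `σ = m τ₁₁ + c τ₁₂`. -/
noncomputable def ofPair {m c e m' c' : ℕ} (hm : 0 < m) (h : Nat.gcd m (Nat.gcd c e) = 1)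
    (hcop : Nat.gcd m' c' = 1) (hcm : m * c' = c * m') : SplitDatum m where
  base := ![0, -(e / m), 0]
  lin := ![![1, 0], ![0, -c'], ![0, m']]
  inv := ![![1, 0, 0], ![0, -Nat.gcdB m' c', Nat.gcdA m' c']]
  l := ![1, 0]
  r := ![1, 0]
  b := ![m, c]
  k := ![0, -e]
  sigma₀ := -(c * e / m)
  slope := ![m, -(c * c')]
  pos := hm
  inv_lin := by
    have hbez := Nat.gcd_eq_gcd_ab m' c'
    rw [hcop] at hbez
    intro i j
    fin_cases i <;> fin_cases j <;> simp
    push_cast at hbez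
    linear_combination -hbez
  r_l := by simp
  coprime := by
    have h1 := Nat.gcd_eq_gcd_ab m (c.gcd e)
    have h2 := Nat.gcd_eq_gcd_ab c e
    rw [h] at h1
    refine ⟨Nat.gcdA m (c.gcd e), Nat.gcdB m (c.gcd e) * Nat.gcdA c e,
      Nat.gcdB m (c.gcd e) * Nat.gcdB c e, ?_⟩
    rw [h2] at h1
    simp
    push_cast at h1
    linear_combination -h1
  pairing := by simp
  relation_zero x y := by
    have hm0 : (m : ℂ) ≠ 0 := by exact_mod_cast hm.ne'
    simp
    field_simp
    ring
  relation_one x y := by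
    have hm0 : (m : ℂ) ≠ 0 := by exact_mod_cast hm.ne'
    have hcm0 : (m : ℂ) * c' = c * m' := by exact_mod_cast hcm
    have hem : (e / m : ℂ) * m = e := div_mul_cancel₀ _ hm0
    simp only [Matrix.cons_val_zero, Matrix.cons_val_one, Matrix.cons_val]
    push_cast
    linear_combination -y * hcm0 - hem

theorem period_ofPair {m c e m' c' : ℕ} (hm : 0 < m) (h : Nat.gcd m (Nat.gcd c e) = 1)
    (hcop : Nat.gcd m' c' = 1) (hcm : m * c' = c * m') (x : Fin 3 → ℂ) :
    (ofPair hm h hcop hcm).period x = ![x 0, -((c * (m' * x 1) + e) / m), m' * x 1] := by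
  have hm0 : (m : ℂ) ≠ 0 := by exact_mod_cast hm.ne'
  have hcm0 : (m : ℂ) * c' = c * m' := by exact_mod_cast hcm
  ext j
  fin_cases j
  · simp [period, ofPair]
  · simp [period, ofPair]
    field_simp
    linear_combination -x 1 * hcm0
  · simp [period, ofPair]

/-- The datum for the index `∞`, with `x₀ = τ₂₂` and `x₁ = τ₁₂` as parameters. The relation is
`τ (-1, m - 1) = σ (-1, 1)` with `σ = (m - 1) τ₂₂ - τ₁₂`. -/
noncomputable def ofInfty {m : ℕ} (hm : 0 < m) : SplitDatum m where
  base := 0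
  lin := ![![m - 1, m - 2], ![0, 1], ![1, 0]]
  inv := ![![0, 0, 1], ![0, 1, 0]]
  l := ![-1, 1]
  r := ![0, 1]
  b := ![-1, m - 1]
  k := 0
  sigma₀ := 0
  slope := ![m - 1, -1]
  pos := hm
  inv_lin := by
    intro i j
    fin_cases i <;> fin_cases j <;> simp
  r_l := by simp
  coprime := ⟨-1, 0, 0, by simp⟩
  pairing := by simp
  relation_zero x y := by
    simp
    ring
  relation_one x y := by
    simp
    ring

theorem period_ofInfty {m : ℕ} (hm : 2 ≤ m) (x : Fin 3 → ℂ) :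
    (ofInfty (Nat.zero_lt_of_lt hm)).period x = ![(m - 1) * x 0 + (m - 2) * x 1, x 1,
      1 / (m - 1) * ((m - 1) * x 0 + (m - 2) * x 1 - (m - 2) * x 1)] := by
  have hm1 : (m : ℂ) - 1 ≠ 0 := by
    have : m ≠ 1 := by omega
    exact sub_ne_zero.2 (by exact_mod_cast this)
  ext j
  fin_cases j <;> simp [period, ofInfty, hm1]

end SplitDatum

theorem mul_div_gcd_comm (m c : ℕ) : m * (c / m.gcd c) = c * (m / m.gcd c) := by
  rw [← Nat.mul_div_assoc _ (Nat.gcd_dvd_right m c), mul_comm m c,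
    Nat.mul_div_assoc _ (Nat.gcd_dvd_left m c)]

/-- The datum of a family index. -/
noncomputable def FamilyIndex.datum {m : ℕ} (hm : 0 < m) : FamilyIndex m → SplitDatum m
  | .pair c _ h => SplitDatum.ofPair (m' := m / m.gcd c) (c' := c / m.gcd c) hm h
      (Nat.coprime_div_gcd_div_gcd (Nat.gcd_pos_of_pos_left c hm)) (mul_div_gcd_comm m c)
  | .infty => SplitDatum.ofInfty hm

theorem FamilyIndex.line_datum {m : ℕ} (hm : 0 < m) (i : FamilyIndex m) :
    (i.datum hm).line = lineOf i := by
  cases i with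
  | pair c e h =>
    have : (fun i => (((![1, 0] : Fin 2 → ℤ) i : ℤ) : ℂ)) = ![1, 0] := by
      ext i
      fin_cases i <;> simp
    exact congrArg (fun v => Submodule.span ℂ {v}) this
  | infty =>
    have : (fun i => (((![-1, 1] : Fin 2 → ℤ) i : ℤ) : ℂ)) = ![-1, 1] := by
      ext i
      fin_cases i <;> simp
    exact congrArg (fun v => Submodule.span ℂ {v}) this

theorem FamilyIndex.range_period {m : ℕ} (hm : 2 ≤ m) (i : FamilyIndex m) :
    Set.range (fun x : (i.datum (Nat.zero_lt_of_lt hm)).space =>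
      (i.datum (Nat.zero_lt_of_lt hm)).period x) = periodSet i := by
  have hm0 := Nat.zero_lt_of_lt hm
  have hm1 : (m : ℂ) - 1 ≠ 0 := by
    have : m ≠ 1 := by omega
    exact sub_ne_zero.2 (by exact_mod_cast this)
  ext t
  cases i with
  | pair c e h =>
    have hper := SplitDatum.period_ofPair hm0 h
      (Nat.coprime_div_gcd_div_gcd (Nat.gcd_pos_of_pos_left c hm0)) (mul_div_gcd_comm m c)
    constructor
    · rintro ⟨x, rfl⟩
      exact ⟨x.2.1, _, _, hper x⟩
    · rintro ⟨ht, u, v, rfl⟩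
      have hg : ((m / m.gcd c : ℕ) : ℂ) ≠ 0 := by
        exact_mod_cast (Nat.div_pos (Nat.gcd_le_left c hm0) (Nat.gcd_pos_of_pos_left c hm0)).ne'
      have hx : ((FamilyIndex.pair c e h).datum hm0).period ![u, v / (m / m.gcd c : ℕ), 1] =
          ![u, -((c * v + e) / m), v] := by
        refine (hper _).trans ?_
        simp only [Matrix.cons_val_zero, Matrix.cons_val_one, mul_div_cancel₀ _ hg]
      exact ⟨⟨_, Set.mem_of_eq_of_mem hx ht, one_ne_zero⟩, hx⟩
  | infty =>
    constructor
    · rintro ⟨x, rfl⟩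
      exact ⟨x.2.1, _, _, SplitDatum.period_ofInfty hm _⟩
    · rintro ⟨ht, v, z, rfl⟩
      have hx : ((FamilyIndex.infty : FamilyIndex m).datum hm0).period
          ![1 / (m - 1) * (v - (m - 2) * z), z, 1] =
          ![v, z, 1 / (m - 1) * (v - (m - 2) * z)] := by
        have hv : (m - 1) * (1 / (m - 1) * (v - (m - 2) * z)) + (m - 2) * z = v := by
          field_simp
          ring
        refine (SplitDatum.period_ofInfty hm _).trans ?_
        simp only [Matrix.cons_val_zero, Matrix.cons_val_one, hv]
      exact ⟨⟨_, Set.mem_of_eq_of_mem hx ht, one_ne_zero⟩, hx⟩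

end SplitSurfaces

theorem mainTheorem7 (m : ℕ) (hm : 2 ≤ m) (i : SplitSurfaces.FamilyIndex m) :
    ∃ (K : Type) (_ : TopologicalSpace K) (_ : T2Space K) (_ : SecondCountableTopology K)
      (_ : ChartedSpace (Fin 3 → ℂ) K) (_ : IsManifold 𝓘(ℂ, Fin 3 → ℂ) ω K)
      (proj : K → (Fin 3 → ℂ)) (φ : K → SplitSurfaces.SurfaceFamily),
      ContMDiff 𝓘(ℂ, Fin 3 → ℂ) 𝓘(ℂ, Fin 3 → ℂ) ω proj ∧
      (∀ x, proj x ∈ SplitSurfaces.baseSet i) ∧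
      ContMDiff 𝓘(ℂ, Fin 3 → ℂ) 𝓘(ℂ, (Fin 3 → ℂ) × (Fin 2 → ℂ)) ω φ ∧
      (∀ x, φ x ∈ SplitSurfaces.restrictedFamily i) ∧
      (∀ x, SplitSurfaces.surfaceProj (φ x) = proj x) ∧
      ∀ T ∈ SplitSurfaces.baseSet i,
        SplitSurfaces.IsEllipticCurveFibre proj T ∧
        Set.InjOn φ (proj ⁻¹' {T}) ∧
        (∀ x ∈ proj ⁻¹' {T}, Function.Injective
          (mfderiv 𝓘(ℂ, Fin 3 → ℂ) 𝓘(ℂ, (Fin 3 → ℂ) × (Fin 2 → ℂ)) φ x)) ∧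
        ∀ (t : Fin 3 → ℂ) (ht : t ∈ SplitSurfaces.siegel), SplitSurfaces.psi t = T →
          φ '' (proj ⁻¹' {T}) = SplitSurfaces.fibreMap t ht ''
            (SplitSurfaces.imageInSurface t (SplitSurfaces.lineOf i) :
              Set (SplitSurfaces.AbelianSurface t)) ∧
          SplitSurfaces.IsAbelianSubvarietyOfExponent t
            (SplitSurfaces.imageInSurface t (SplitSurfaces.lineOf i)) m := by
  have hm0 : 0 < m := Nat.zero_lt_of_lt hm
  have hbase : ∀ y, (i.datum hm0).proj y ∈ SplitSurfaces.baseSet i := by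
    intro y
    obtain ⟨x, rfl⟩ := (i.datum hm0).toCurves_surjective y
    exact ⟨_, i.range_period hm ▸ ⟨x, rfl⟩, rfl⟩
  refine ⟨(i.datum hm0).Curves, inferInstance, inferInstance, inferInstance, inferInstance,
    inferInstance, (i.datum hm0).proj, (i.datum hm0).toFamily, (i.datum hm0).contMDiff_proj, hbase,
    (i.datum hm0).contMDiff_toFamily, hbase, fun _ => rfl, ?_⟩
  rintro _ ⟨t₀, ht₀, rfl⟩
  obtain ⟨x, rfl⟩ := (i.range_period hm).symm ▸ ht₀
  refine ⟨(i.datum hm0).isEllipticCurveFibre x, (i.datum hm0).injOn_toFamily x,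
    fun y _ => (i.datum hm0).injective_mfderiv_toFamily y, fun t ht h => ?_⟩
  rw [← i.line_datum hm0]
  exact ⟨(i.datum hm0).image_toFamily x ht h, (i.datum hm0).isAbelianSubvarietyOfExponent x h⟩
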